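/- Let $|n\rangle\in L^2(\mathbb R)$, $n\ge 0$, denote the Hermite function $h_n(x)=(2^n n!)^{-1/2}\pi^{-1/4}H_n(x)e^{-x^2/2}$ ($H_n$ the physicists' Hermite polynomial), and let $\mathcal H^N=\mathrm{span}\{|0\rangle,\dots,|N\rangle\}$. For a Hilbert subspace $\mathcal H\subseteq L^2(\mathbb R)$ let $\mathcal A(\mathcal H)$ be the set of self-adjoint trace-class operators on $\mathcal H$ of trace one, $\mathcal D(\mathcal H)=\{\rho\in\mathcal A(\mathcal H):\rho\ge 0\}$, and $\mathcal D_+(\mathcal H)=\{\rho\in\mathcal D(\mathcal H): W\rho(x,\xi)\ge 0 \text{ for all } (x,\xi)\in\mathbb R^2\}$, where $$W\rho(x,\xi)=\frac1{2\pi}\int_{\mathbb R}e^{-i\xi y}K_\rho\bigl(x+\tfrac y2,x-\tfrac y2\bigr)\,dy=\sum_i W(\rho e_i,e_i)(x,\xi)$$ is the Wigner function of $\rho$. Here $K_\rho(x,y)=\sum_i(\rho e_i)(x)\overline{e_i(y)}$ is the integral kernel of $\rho$, $(e_i)$ is any orthonormal basis of $\mathcal H$, and $W(\psi,\varphi)(x,\xi)=\frac1{2\pi}\int_{\mathbb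 R}e^{-i\xi y}\psi(x+\frac y2)\overline{\varphi(x-\frac y2)}\,dy$. For $S\subseteq X\subseteq\mathcal A(\mathcal H)$ let $\mathrm{int}_X S$ be the interior of $S$ in $X$ for the topology induced on $X$ by the trace norm $\|\rho\|_1=\mathrm{tr}|\rho|$, let $\mathrm{Aff}(S)$ be the (real) affine hull of $S$, and let $\mathrm{iint}\,S=\mathrm{int}_{\mathrm{Aff}(S)}S$. Let $N\ge 0$. (A) If $\mathcal H\subseteq\mathcal H^N$ is a subspace with $|0\rangle\perp\mathcal H$, then $\mathcal D_+(\mathcal H)=\emptyset$. (B) If $\mathcal H\subseteq\mathcal H^N$ is a subspace with $|0\rangle\in\mathcal H$, then $\mathrm{int}_{\mathcal A(\mathcal H)}\mathcal D_+(\mathcal H)\neq\emptyset$, and moreover $\mathrm{Aff}(\mathcal D_+(\mathcal H))=\mathrm{Aff}(\mathcal D(\mathcal H))=\mathcal A(\mathcal H)$ and $\mathrm{int}_{\mathcal A(\mathcal H)}\mathcal D_+(\mathcal H)=\mathrm{iint}\,\mathcal D_+(\mathcal H)$. (C) If $|0\rangle\notin\mathcal H$ and $|0\rangle\not\perp\mathcal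 H$, both cases are possible: for every $N\ge 2$ there is a subspace $\mathcal H\subseteq\mathcal H^N$ with $|0\rangle\notin\mathcal H$, $|0\rangle\not\perp\mathcal H$ and $\mathcal D_+(\mathcal H)=\emptyset$, and there is a subspace $\mathcal H\subseteq\mathcal H^N$ with $|0\rangle\notin\mathcal H$, $|0\rangle\not\perp\mathcal H$ and $\mathrm{int}_{\mathcal A(\mathcal H)}\mathcal D_+(\mathcal H)\ne\emptyset$. -/

import Mathlib

open MeasureTheory

namespace WignerPositive

noncomputable section

/-! ### Trace-class operators on a Hilbert space -/

section Operators

variable (E : Type*) [NormedAddCommGroup E] [InnerProductSpace ℂ E] [CompleteSpace E]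

/-- The index set of a chosen orthonormal (Hilbert) basis of `E`. -/
def BasisIndex : Set E := (exists_hilbertBasis ℂ E).choose

/-- A chosen orthonormal (Hilbert) basis of `E`. The quantities below that are written with it
do not depend on the choice. -/
def basis : HilbertBasis (BasisIndex E) ℂ E := (exists_hilbertBasis ℂ E).choose_spec.choose

variable {E}

/-- The absolute value `|T| = √(T† T)` of a bounded operator, where the square root is the
positive one. -/
def absOp (T : E →L[ℂ] E) : E →L[ℂ] E := CFC.sqrt (ContinuousLinearMap.adjoint T * T)

/-- `tr T = ∑ₙ ⟨eₙ, T eₙ⟩`. -/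
def trace (T : E →L[ℂ] E) : ℂ := ∑' i, inner ℂ (basis E i) (T (basis E i))

/-- `T` is trace class if `tr |T| < ∞`. -/
def IsTraceClass (T : E →L[ℂ] E) : Prop :=
  Summable fun i => inner ℂ (basis E i) (absOp T (basis E i))

/-- The trace norm `‖T‖₁ = tr |T|`. -/
def traceNorm (T : E →L[ℂ] E) : ℝ := (trace (absOp T)).re

/-- The interior of `S` relative to `X`, for the topology induced on `X` by the trace norm. -/
def relInterior (X S : Set (E →L[ℂ] E)) : Set (E →L[ℂ] E) :=
  {ρ | ρ ∈ X ∧ ∃ ε : ℝ, 0 < ε ∧ ∀ σ ∈ X, traceNorm (σ - ρ) < ε → σ ∈ S}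

/-- The affine hull of `S` (over the real numbers). -/
def affHull (S : Set (E →L[ℂ] E)) : Set (E →L[ℂ] E) := (affineSpan ℝ S : Set (E →L[ℂ] E))

/-- The intrinsic interior of `S`: its interior relative to its affine hull. -/
def intrinsicInt (S : Set (E →L[ℂ] E)) : Set (E →L[ℂ] E) := relInterior (affHull S) S

variable (E) in
/-- The self-adjoint trace-class operators with unit trace. -/
def unitTrace : Set (E →L[ℂ] E) := {ρ | IsTraceClass ρ ∧ IsSelfAdjoint ρ ∧ trace ρ = 1}

variable (E) in
/-- The density matrices: positive semidefinite operators of trace one. -/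
def densityMatrices : Set (E →L[ℂ] E) := {ρ | ρ ∈ unitTrace E ∧ ρ.IsPositive}

end Operators

/-! ### Fock states -/

/-- The space `L²(ℝ)` of complex-valued functions. -/
abbrev L2 : Type := Lp ℂ 2 (volume : Measure ℝ)

/-- The physicists' Hermite polynomials, `H₀ = 1`, `Hₙ₊₁ = 2 X Hₙ - Hₙ'`. -/
def hermiteH : ℕ → Polynomial ℝ
  | 0 => 1
  | n + 1 => 2 * Polynomial.X * hermiteH n - Polynomial.derivative (hermiteH n)

/-- The Hermite function `hₙ(x) = (2ⁿ n!)^(-1/2) π^(-1/4) Hₙ(x) exp(-x²/2)`. -/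
def hermiteFun (n : ℕ) (x : ℝ) : ℝ :=
  ((2 : ℝ) ^ n * (n.factorial : ℝ)) ^ (-(1 / 2) : ℝ) * Real.pi ^ (-(1 / 4) : ℝ) *
    (hermiteH n).eval x * Real.exp (-(x ^ 2) / 2)

theorem memLp_poly (p : Polynomial ℝ) :
    MemLp (fun x : ℝ => p.eval x * Real.exp (-(x ^ 2) / 2)) 2 volume := by
  induction p using Polynomial.induction_on' with
  | add p q hp hq =>
    have := hp.add hq
    refine this.congr_norm ?_ ?_ |>.ae_eq (Filter.Eventually.of_forall fun x => rfl)
    · exact (by fun_prop : Continuous _).aestronglyMeasurable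
    · refine Filter.Eventually.of_forall fun x => ?_
      simp [add_mul]
  | monomial n a =>
    rw [memLp_two_iff_integrable_sq (by fun_prop : Continuous _).aestronglyMeasurable]
    have h := (integrable_rpow_mul_exp_neg_mul_sq (b := 1) one_pos
      (s := ((2 * n : ℕ) : ℝ)) (lt_of_lt_of_le (by norm_num) (Nat.cast_nonneg _))).const_mul (a ^ 2)
    refine h.congr (Filter.Eventually.of_forall fun x => ?_)
    have e : Real.exp (-(x ^ 2) / 2) ^ 2 = Real.exp (-1 * x ^ 2) := by
      rw [← Real.exp_nat_mul]; congr 1; push_cast; ring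
    simp only [Real.rpow_natCast, Polynomial.eval_monomial, mul_pow, e]
    ring

theorem memLp_hermiteFun (n : ℕ) :
    MemLp (fun x : ℝ => (hermiteFun n x : ℂ)) 2 volume := by
  have h := (memLp_poly (hermiteH n)).const_mul
    (((2 : ℝ) ^ n * (n.factorial : ℝ)) ^ (-(1 / 2) : ℝ) * Real.pi ^ (-(1 / 4) : ℝ))
  have h2 : MemLp (hermiteFun n) 2 volume := by
    convert h using 2 with x
    simp only [hermiteFun]; ring
  exact h2.ofReal

/-- The Fock state `|n⟩` of `L²(ℝ)`. -/
def fock (n : ℕ) : L2 := (memLp_hermiteFun n).toLp _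

/-- The space `ℋᴺ`, the span of `|0⟩, …, |N⟩`. -/
def fockSpan (N : ℕ) : Submodule ℂ L2 := Submodule.span ℂ {ψ | ∃ n ≤ N, ψ = fock n}

/-! ### Wigner functions -/

/-- The cross-Wigner function
`W(ψ, φ)(x, ξ) = (2π)⁻¹ ∫ exp(-iξy) ψ(x + y/2) conj (φ(x - y/2)) dy`; the integral does not
depend on the representatives of `ψ` and `φ`. -/
def crossWigner (ψ φ : L2) (x ξ : ℝ) : ℂ :=
  (1 / (2 * Real.pi : ℝ) : ℂ) * ∫ y : ℝ,
    Complex.exp (-(Complex.I * ξ * y)) * ψ (x + y / 2) * starRingEnd ℂ (φ (x - y / 2))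

/-- The Wigner function of an operator `ρ` on a Hilbert subspace `H` of `L²(ℝ)`. In an
orthonormal basis `(eᵢ)` of `H` one has `ρ = ∑ᵢ |ρ eᵢ⟩⟨eᵢ|`, so that `ρ` has the integral kernel
`K(x, y) = ∑ᵢ (ρ eᵢ)(x) conj (eᵢ(y))`, and
`Wρ(x, ξ) = (2π)⁻¹ ∫ exp(-iξy) K(x + y/2, x - y/2) dy` is the sum of the `W(ρ eᵢ, eᵢ)(x, ξ)`. -/
def wigner {H : Submodule ℂ L2} [CompleteSpace H] (ρ : H →L[ℂ] H) (x ξ : ℝ) : ℂ :=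
  ∑' i, crossWigner (ρ (basis H i) : L2) (basis H i : L2) x ξ

/-- The Wigner-positive states on `H`. The Wigner function of a self-adjoint operator is
real-valued, so its real part is the function itself. -/
def wignerPositive (H : Submodule ℂ L2) [CompleteSpace H] : Set (H →L[ℂ] H) :=
  {ρ | ρ ∈ densityMatrices H ∧ ∀ x ξ : ℝ, 0 ≤ (wigner ρ x ξ).re}

end

end WignerPositive

open WignerPositive

/-!
A vector of `ℋᴺ` is a polynomial of degree at most `N` times the Gaussian `exp(-x²/2)`
(`mem_fockSpan_iff`). For two such vectors, completing the square and shifting the contour turns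
the cross-Wigner function at `z = x + iξ` into `π⁻¹ exp(-|z|²) ∫ p(z̄ + t) q̄(z - t) exp(-t²) dt`
(`crossWigner_polyGauss`), where the integral is a polynomial in `z` and `z̄`. This formula gives
the upper and lower bounds on Wigner functions that produce interior points.

*Spaces containing the vacuum.* Let `D` be the largest degree that occurs in `H`. All Wigner
functions of operators on `H` are at most a multiple, proportional to the norm of the operator, of
the envelope `(1 + |z|²)ᴰ exp(-|z|²)` (`exists_norm_wigner_le`). A vector of degree `D` has a
Wigner function bounded below by a positive multiple of the envelope minus a multiple of
`exp(-|z|²)` (`exists_le_re_wignerPoly_self`), and the latter is the Wigner function of the vacuum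
up to a factor. So some positive combination of the two states has a Wigner function above a
positive multiple of the envelope. After a small multiple of the identity is added, positivity of
the operator and of its Wigner function both survive small perturbations
(`relInterior_wignerPositive_nonempty`). An interior point forces the affine hull to be everything
(`affHull_eq_unitTrace`).

*Spaces orthogonal to the vacuum.* The Wigner function of the vacuum is a multiple of
`exp(-|z|²)`. By a case of Moyal's identity the integral of `Wρ` against it is a multiple of
`⟨0|ρ|0⟩ = 0`, so a nonnegative `Wρ` vanishes almost everywhere. By Fourier inversion the kernel
of `ρ` then vanishes on the diagonal, which contradicts `tr ρ = 1`
(`wignerPositive_eq_empty_of_fock_zero_mem_orthogonal`).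

*General position.* The only state on the line spanned by `(1 + x) exp(-x²/2)` has a Wigner
function that is negative at `(-1, 0)`. On the plane spanned by `ψ = (1 + x²) exp(-x²/2)` and `φ =
x exp(-x²/2)` the operator `|ψ⟩⟨ψ| + 5 |φ⟩⟨φ|` has a Wigner function proportional to `(1/4 + 6x² +
|z|⁴) exp(-|z|²)`, and the perturbation argument applies again.
-/

namespace WignerPositive

open Polynomial Filter Topology ComplexConjugate InnerProductSpace

noncomputable section

/-! ### Gaussian integrals of polynomials -/

theorem integrable_pow_mul_exp_neg_sq (n : ℕ) :
    Integrable fun t : ℝ => t ^ n * Real.exp (-t ^ 2) := by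
  have h := integrable_rpow_mul_exp_neg_mul_sq (b := 1) one_pos (s := (n : ℝ))
    (lt_of_lt_of_le (by norm_num) (Nat.cast_nonneg _))
  simpa using h

theorem integrable_one_add_abs_pow_mul_exp_neg_sq (n : ℕ) :
    Integrable fun t : ℝ => (1 + |t|) ^ n * Real.exp (-t ^ 2) := by
  have h : ∀ t : ℝ, (1 + |t|) ^ n * Real.exp (-t ^ 2)
      = ∑ k ∈ Finset.range (n + 1), (n.choose k : ℝ) * ‖t ^ k * Real.exp (-t ^ 2)‖ := by
    intro t
    rw [add_comm, add_pow, Finset.sum_mul]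
    refine Finset.sum_congr rfl fun k _ => ?_
    rw [norm_mul, norm_pow, Real.norm_eq_abs, Real.norm_of_nonneg (Real.exp_pos _).le]
    ring
  simp_rw [h]
  exact integrable_finsetSum _ fun k _ => ((integrable_pow_mul_exp_neg_sq k).norm.const_mul _)

theorem exists_norm_eval_le (p : ℂ[X]) {n : ℕ} (hp : p.natDegree ≤ n) :
    ∃ C : ℝ, 0 ≤ C ∧ ∀ w : ℂ, ‖p.eval w‖ ≤ C * (1 + ‖w‖) ^ n := by
  refine ⟨∑ k ∈ Finset.range (n + 1), ‖p.coeff k‖, by positivity, fun w => ?_⟩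
  rw [p.eval_eq_sum_range' (Nat.lt_succ_of_le hp), Finset.sum_mul]
  refine (norm_sum_le _ _).trans (Finset.sum_le_sum fun k hk => ?_)
  rw [norm_mul, norm_pow]
  gcongr
  calc ‖w‖ ^ k ≤ (1 + ‖w‖) ^ k := by gcongr; linarith
    _ ≤ (1 + ‖w‖) ^ n :=
      pow_le_pow_right₀ (by linarith [norm_nonneg w]) (Finset.mem_range_succ_iff.1 hk)

theorem norm_cexp_neg_add_mul_I_sq (t c : ℝ) :
    ‖Complex.exp (-((t : ℂ) + c * Complex.I) ^ 2)‖ = Real.exp (c ^ 2) * Real.exp (-t ^ 2) := by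
  rw [Complex.norm_exp, ← Real.exp_add]
  congr 1
  simp [pow_two]
  ring

theorem integrable_eval_mul_cexp_shift (p : ℂ[X]) (c : ℝ) :
    Integrable fun t : ℝ => p.eval ((t : ℂ) + c * Complex.I) *
      Complex.exp (-((t : ℂ) + c * Complex.I) ^ 2) := by
  obtain ⟨C, hC, h⟩ := exists_norm_eval_le (p.comp (X + Polynomial.C (c * Complex.I))) le_rfl
  refine ((integrable_one_add_abs_pow_mul_exp_neg_sq
    (p.comp (X + Polynomial.C (c * Complex.I))).natDegree).const_mul
      (C * Real.exp (c ^ 2))).mono' (by fun_prop : Continuous _).aestronglyMeasurable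
      (Eventually.of_forall fun t => ?_)
  rw [norm_mul, norm_cexp_neg_add_mul_I_sq]
  have := h t
  simp only [eval_comp, eval_add, eval_X, eval_C, Complex.norm_real, Real.norm_eq_abs] at this
  calc _ ≤ (C * (1 + |t|) ^ _) * (Real.exp (c ^ 2) * Real.exp (-t ^ 2)) := by gcongr
    _ = _ := by ring

theorem integrable_eval_mul_cexp (p : ℂ[X]) :
    Integrable fun t : ℝ => p.eval (t : ℂ) * Complex.exp (-(t : ℂ) ^ 2) := by
  simpa using integrable_eval_mul_cexp_shift p 0

/-- Integration by parts for the moments of a shifted Gaussian. -/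
theorem integral_shift_pow_add_two (n : ℕ) (c : ℝ) :
    ∫ t : ℝ, ((t : ℂ) + c * Complex.I) ^ (n + 2) *
        Complex.exp (-((t : ℂ) + c * Complex.I) ^ 2)
      = (n + 1) / 2 * ∫ t : ℝ, ((t : ℂ) + c * Complex.I) ^ n *
        Complex.exp (-((t : ℂ) + c * Complex.I) ^ 2) := by
  have hi : ∀ k : ℕ, Integrable fun t : ℝ => ((t : ℂ) + c * Complex.I) ^ k *
      Complex.exp (-((t : ℂ) + c * Complex.I) ^ 2) := fun k => by
    simpa using integrable_eval_mul_cexp_shift (X ^ k) c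
  have hd : ∀ t : ℝ, HasDerivAt (fun t : ℝ => ((t : ℂ) + c * Complex.I) ^ (n + 1) *
      Complex.exp (-((t : ℂ) + c * Complex.I) ^ 2))
      ((n + 1) * (((t : ℂ) + c * Complex.I) ^ n * Complex.exp (-((t : ℂ) + c * Complex.I) ^ 2))
        - 2 * (((t : ℂ) + c * Complex.I) ^ (n + 2) *
          Complex.exp (-((t : ℂ) + c * Complex.I) ^ 2))) t := by
    intro t
    have h0 : HasDerivAt (fun t : ℝ => (t : ℂ) + c * Complex.I) 1 t :=
      Complex.ofRealCLM.hasDerivAt.add_const _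
    refine ((h0.fun_pow (n + 1)).fun_mul (h0.fun_pow 2).fun_neg.cexp).congr_deriv ?_
    rw [Nat.add_sub_cancel]
    push_cast
    ring
  have := integral_eq_zero_of_hasDerivAt_of_integrable hd
    (((hi n).const_mul _).sub ((hi (n + 2)).const_mul _)) (hi (n + 1))
  rw [integral_sub ((hi n).const_mul _) ((hi (n + 2)).const_mul _), integral_const_mul,
    integral_const_mul] at this
  linear_combination (-1 / 2 : ℂ) * this

theorem integral_shift_pow_one (c : ℝ) :
    ∫ t : ℝ, ((t : ℂ) + c * Complex.I) ^ 1 *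
        Complex.exp (-((t : ℂ) + c * Complex.I) ^ 2) = 0 := by
  have hi : ∀ k : ℕ, Integrable fun t : ℝ => ((t : ℂ) + c * Complex.I) ^ k *
      Complex.exp (-((t : ℂ) + c * Complex.I) ^ 2) := fun k => by
    simpa using integrable_eval_mul_cexp_shift (X ^ k) c
  have hd : ∀ t : ℝ, HasDerivAt (fun t : ℝ => Complex.exp (-((t : ℂ) + c * Complex.I) ^ 2))
      (-2 * (((t : ℂ) + c * Complex.I) ^ 1 *
          Complex.exp (-((t : ℂ) + c * Complex.I) ^ 2))) t := by
    intro t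
    have h0 : HasDerivAt (fun t : ℝ => (t : ℂ) + c * Complex.I) 1 t :=
      Complex.ofRealCLM.hasDerivAt.add_const _
    convert (h0.fun_pow 2).fun_neg.cexp using 1
    simp
    ring
  have := integral_eq_zero_of_hasDerivAt_of_integrable hd
    ((hi 1).const_mul _) (by simpa using hi 0)
  rw [integral_const_mul] at this
  simpa using this

theorem integral_shift_pow_zero (c : ℝ) :
    ∫ t : ℝ, ((t : ℂ) + c * Complex.I) ^ 0 *
        Complex.exp (-((t : ℂ) + c * Complex.I) ^ 2) = (√Real.pi : ℝ) := by
  have := GaussianFourier.integral_cexp_neg_mul_sq_add_real_mul_I (b := 1) (by simp) c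
  simp only [pow_zero, one_mul]
  simp only [neg_mul, one_mul, div_one] at this
  rw [this, Real.sqrt_eq_rpow, Complex.ofReal_cpow Real.pi_pos.le]
  norm_num

/-- Contour shift: the line of integration of a polynomial times a Gaussian may be moved
parallel to the real axis. -/
theorem integral_eval_mul_cexp_shift (p : ℂ[X]) (c : ℝ) :
    ∫ t : ℝ, p.eval ((t : ℂ) + c * Complex.I) * Complex.exp (-((t : ℂ) + c * Complex.I) ^ 2)
      = ∫ t : ℝ, p.eval (t : ℂ) * Complex.exp (-(t : ℂ) ^ 2) := by
  have key : ∀ n : ℕ, ∫ t : ℝ, ((t : ℂ) + c * Complex.I) ^ n *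
      Complex.exp (-((t : ℂ) + c * Complex.I) ^ 2)
      = ∫ t : ℝ, ((t : ℂ) + (0 : ℝ) * Complex.I) ^ n *
      Complex.exp (-((t : ℂ) + (0 : ℝ) * Complex.I) ^ 2) := by
    intro n
    induction n using Nat.twoStepInduction with
    | zero => rw [integral_shift_pow_zero, integral_shift_pow_zero]
    | one => rw [integral_shift_pow_one, integral_shift_pow_one]
    | more n ih _ => rw [integral_shift_pow_add_two, integral_shift_pow_add_two, ih]
  induction p using Polynomial.induction_on' with
  | add p q hp hq =>
    simp only [eval_add, add_mul]
    rw [integral_add (integrable_eval_mul_cexp_shift p c) (integrable_eval_mul_cexp_shift q c),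
      integral_add (integrable_eval_mul_cexp p) (integrable_eval_mul_cexp q), hp, hq]
  | monomial n a =>
    simp only [eval_monomial, mul_assoc]
    rw [integral_const_mul, integral_const_mul, key]
    simp

theorem integral_quartic_mul_cexp (a₀ a₁ a₂ a₃ a₄ : ℂ) :
    ∫ t : ℝ, (a₀ + a₁ * t + a₂ * t ^ 2 + a₃ * t ^ 3 + a₄ * t ^ 4) * Complex.exp (-(t : ℂ) ^ 2)
      = (√Real.pi : ℝ) * (a₀ + a₂ / 2 + 3 / 4 * a₄) := by
  have hi : ∀ k : ℕ, Integrable fun t : ℝ => (t : ℂ) ^ k * Complex.exp (-(t : ℂ) ^ 2) :=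
    fun k => by simpa using integrable_eval_mul_cexp (X ^ k)
  have h0 := integral_shift_pow_zero 0
  have h1 := integral_shift_pow_one 0
  have h2 := integral_shift_pow_add_two 0 0
  have h3 := integral_shift_pow_add_two 1 0
  have h4 := integral_shift_pow_add_two 2 0
  rw [h0] at h2
  rw [h1] at h3
  rw [h2] at h4
  norm_num at h0 h1 h2 h3 h4
  have e : ∀ t : ℝ, (a₀ + a₁ * t + a₂ * t ^ 2 + a₃ * t ^ 3 + a₄ * t ^ 4) *
      Complex.exp (-(t : ℂ) ^ 2) = a₀ * (t ^ 0 * Complex.exp (-(t : ℂ) ^ 2))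
        + a₁ * (t ^ 1 * Complex.exp (-(t : ℂ) ^ 2)) + a₂ * (t ^ 2 * Complex.exp (-(t : ℂ) ^ 2))
        + a₃ * (t ^ 3 * Complex.exp (-(t : ℂ) ^ 2))
        + a₄ * (t ^ 4 * Complex.exp (-(t : ℂ) ^ 2)) := fun t => by ring
  simp_rw [e]
  rw [integral_add, integral_add, integral_add, integral_add]
  · simp only [integral_const_mul, pow_zero, one_mul, pow_one]
    rw [h0, h1, h2, h3, h4]
    ring
  all_goals
    have := fun k a => (hi k).const_mul a
    first
      | exact this _ _
      | exact (this _ _).add (this _ _)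
      | exact ((this _ _).add (this _ _)).add (this _ _)
      | exact (((this _ _).add (this _ _)).add (this _ _)).add (this _ _)

/-! ### Polynomials times the Gaussian -/

/-- The function `x ↦ p(x) exp(-x²/2)`. -/
def gaussFun (p : ℂ[X]) (x : ℝ) : ℂ := p.eval (x : ℂ) * Complex.exp (-(x : ℂ) ^ 2 / 2)

theorem continuous_gaussFun (p : ℂ[X]) : Continuous (gaussFun p) := by
  unfold gaussFun; fun_prop

theorem norm_cexp_neg_sq_div_two (x : ℝ) :
    ‖Complex.exp (-(x : ℂ) ^ 2 / 2)‖ = Real.exp (-x ^ 2 / 2) := by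
  rw [Complex.norm_exp]
  norm_cast

theorem norm_cexp_neg_sq (x : ℝ) : ‖Complex.exp (-(x : ℂ) ^ 2)‖ = Real.exp (-x ^ 2) := by
  rw [Complex.norm_exp]
  norm_cast

theorem memLp_gaussFun (p : ℂ[X]) : MemLp (gaussFun p) 2 volume := by
  rw [memLp_two_iff_integrable_sq_norm (continuous_gaussFun p).aestronglyMeasurable]
  have h := (integrable_eval_mul_cexp (p ^ 2)).norm
  refine h.congr (Eventually.of_forall fun x => ?_)
  simp only [gaussFun, norm_mul, mul_pow, eval_pow, norm_pow]
  rw [norm_cexp_neg_sq, norm_cexp_neg_sq_div_two, ← Real.exp_nat_mul]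
  congr 2
  push_cast
  ring

/-- The element of `L²(ℝ)` given by a polynomial times the Gaussian `exp(-x²/2)`. -/
def polyGauss : ℂ[X] →ₗ[ℂ] L2 where
  toFun p := (memLp_gaussFun p).toLp _
  map_add' p q := by
    rw [← MemLp.toLp_add]
    congr 1
    ext x
    simp [gaussFun, add_mul]
  map_smul' a p := by
    rw [RingHom.id_apply, ← MemLp.toLp_const_smul]
    congr 1
    ext x
    simp [gaussFun, mul_assoc]

theorem coeFn_polyGauss (p : ℂ[X]) : polyGauss p =ᵐ[volume] gaussFun p :=
  (memLp_gaussFun p).coeFn_toLp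

theorem conj_gaussFun (p : ℂ[X]) (x : ℝ) :
    conj (gaussFun p x) = gaussFun (p.map (starRingEnd ℂ)) x := by
  have h : (starRingEnd ℂ) (p.eval (x : ℂ)) = (p.map (starRingEnd ℂ)).eval (x : ℂ) := by
    rw [← eval_map_apply, Complex.conj_ofReal]
  rw [gaussFun, gaussFun, map_mul, h, ← Complex.exp_conj, map_div₀, map_neg, map_pow,
    Complex.conj_ofReal, Complex.conj_ofNat]

theorem gaussFun_mul_gaussFun (p q : ℂ[X]) (x : ℝ) :
    gaussFun p x * gaussFun q x = (p * q).eval (x : ℂ) * Complex.exp (-(x : ℂ) ^ 2) := by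
  have : Complex.exp (-(x : ℂ) ^ 2)
      = Complex.exp (-(x : ℂ) ^ 2 / 2) * Complex.exp (-(x : ℂ) ^ 2 / 2) := by
    rw [← Complex.exp_add]; congr 1; ring
  rw [gaussFun, gaussFun, this, eval_mul]
  ring

theorem inner_polyGauss (p q : ℂ[X]) :
    inner ℂ (polyGauss p) (polyGauss q) = ∫ x : ℝ, gaussFun q x * conj (gaussFun p x) := by
  rw [L2.inner_def]
  refine integral_congr_ae ?_
  filter_upwards [coeFn_polyGauss p, coeFn_polyGauss q] with x hp hq
  rw [hp, hq, RCLike.inner_apply]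

theorem polyGauss_injective : Function.Injective polyGauss := by
  rw [injective_iff_map_eq_zero]
  intro p hp
  have h0 : gaussFun p =ᵐ[volume] fun _ => 0 := by
    refine (coeFn_polyGauss p).symm.trans ?_
    rw [hp]
    exact Lp.coeFn_zero _ _ _
  have h1 := (continuous_gaussFun p).ae_eq_iff_eq volume continuous_const |>.1 h0
  refine p.eq_zero_of_infinite_isRoot (Set.infinite_of_injective_forall_mem
    (f := fun x : ℝ => (x : ℂ)) Complex.ofReal_injective fun x => ?_)
  simpa [gaussFun] using congrFun h1 x

theorem hermiteH_natDegree_le (n : ℕ) : (hermiteH n).natDegree ≤ n := by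
  induction n with
  | zero => simp [hermiteH]
  | succ n ih =>
    rw [hermiteH]
    refine (natDegree_sub_le _ _).trans (max_le ?_ ?_)
    · refine natDegree_mul_le.trans ?_
      have : (2 * X : ℝ[X]).natDegree ≤ 1 := by simp
      omega
    · exact (natDegree_derivative_le _).trans (by omega)

theorem hermiteH_coeff_self (n : ℕ) : (hermiteH n).coeff n = 2 ^ n := by
  induction n with
  | zero => simp [hermiteH]
  | succ n ih =>
    rw [hermiteH, coeff_sub, mul_assoc, coeff_ofNat_mul, coeff_X_mul, ih, coeff_derivative,
      coeff_eq_zero_of_natDegree_lt ((hermiteH_natDegree_le n).trans_lt (by omega))]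
    ring

/-- The positive factor that normalizes the `n`-th Hermite function. -/
def hermiteNorm (n : ℕ) : ℝ :=
  ((2 : ℝ) ^ n * (n.factorial : ℝ)) ^ (-(1 / 2) : ℝ) * Real.pi ^ (-(1 / 4) : ℝ)

theorem hermiteNorm_pos (n : ℕ) : 0 < hermiteNorm n := by
  have := Real.pi_pos
  unfold hermiteNorm
  positivity

theorem fock_eq_polyGauss (n : ℕ) :
    fock n = polyGauss ((hermiteNorm n : ℂ) • (hermiteH n).map (algebraMap ℝ ℂ)) := by
  refine MemLp.toLp_congr (memLp_hermiteFun n) (memLp_gaussFun _) (Eventually.of_forall fun x => ?_)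
  simp only [hermiteFun, gaussFun, eval_smul, smul_eq_mul, hermiteNorm]
  push_cast
  rw [← Complex.coe_algebraMap, eval_map_algebraMap, aeval_algebraMap_apply]
  simp

theorem fock_zero_eq : fock 0 = (hermiteNorm 0 : ℂ) • polyGauss 1 := by
  rw [fock_eq_polyGauss, map_smul]
  simp [hermiteH]

theorem polyGauss_one_eq : polyGauss 1 = (hermiteNorm 0 : ℂ)⁻¹ • fock 0 := by
  rw [fock_zero_eq, smul_smul, inv_mul_cancel₀ (by exact_mod_cast (hermiteNorm_pos 0).ne'),
    one_smul]

/-- The space `ℋᴺ` consists of the polynomials of degree at most `N` times the Gaussian. -/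
theorem mem_fockSpan_iff {N : ℕ} {ψ : L2} :
    ψ ∈ fockSpan N ↔ ∃ p : ℂ[X], p.natDegree ≤ N ∧ polyGauss p = ψ := by
  constructor
  · intro h
    have : fockSpan N ≤ (degreeLE ℂ N).map polyGauss := by
      refine Submodule.span_le.2 ?_
      rintro _ ⟨n, hn, rfl⟩
      refine ⟨_, mem_degreeLE.2 ?_, (fock_eq_polyGauss n).symm⟩
      rw [← natDegree_le_iff_degree_le]
      exact (natDegree_smul_le _ _).trans ((natDegree_map_le).trans
        ((hermiteH_natDegree_le n).trans hn))
    obtain ⟨p, hp, rfl⟩ := this h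
    exact ⟨p, natDegree_le_iff_degree_le.2 (mem_degreeLE.1 hp), rfl⟩
  · rintro ⟨p, hp, rfl⟩
    suffices ∀ n ≤ N, ∀ p : ℂ[X], p.natDegree ≤ n → polyGauss p ∈ fockSpan N from
      this N le_rfl p hp
    intro n
    induction n with
    | zero =>
      intro _ p hp
      rw [eq_C_of_natDegree_le_zero hp, ← mul_one (C _), ← smul_eq_C_mul, map_smul,
        polyGauss_one_eq]
      exact Submodule.smul_mem _ _ (Submodule.smul_mem _ _
        (Submodule.subset_span ⟨0, by simp, rfl⟩))
    | succ n ih =>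
      intro hn p hp
      -- subtract the multiple of the Hermite polynomial that has the same leading coefficient
      set h : ℂ[X] := (hermiteNorm (n + 1) : ℂ) • (hermiteH (n + 1)).map (algebraMap ℝ ℂ) with hh
      have hdeg : h.natDegree ≤ n + 1 := (natDegree_smul_le _ _).trans
        ((natDegree_map_le).trans (hermiteH_natDegree_le _))
      have hc : h.coeff (n + 1) ≠ 0 := by
        have := (hermiteNorm_pos (n + 1)).ne'
        simp [hh, hermiteH_coeff_self, this]
      set a := p.coeff (n + 1) / h.coeff (n + 1)
      have e : p = (p - a • h) + a • h := by ring
      have hlt : (p - a • h).natDegree ≤ n := by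
        have h1 : (p - a • h).natDegree ≤ n + 1 :=
          (natDegree_sub_le _ _).trans (max_le hp ((natDegree_smul_le _ _).trans hdeg))
        have h2 : (p - a • h).coeff (n + 1) = 0 := by
          simp [a, div_mul_cancel₀ _ hc]
        by_contra hcon
        have h3 : (p - a • h).natDegree = n + 1 := by omega
        rw [← h3, coeff_natDegree, leadingCoeff_eq_zero] at h2
        rw [h2] at h3
        simp at h3
      rw [e, map_add, map_smul, ← fock_eq_polyGauss]
      exact add_mem (ih (by omega) _ hlt)
        (Submodule.smul_mem _ _ (Submodule.subset_span ⟨_, hn, rfl⟩))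

/-! ### Wigner functions of polynomials times the Gaussian -/

theorem crossWigner_polyGauss_eq_integral (p q : ℂ[X]) (x ξ : ℝ) :
    crossWigner (polyGauss p) (polyGauss q) x ξ = (1 / (2 * Real.pi : ℝ) : ℂ) * ∫ y : ℝ,
      Complex.exp (-(Complex.I * ξ * y)) *
        (gaussFun p (x + y / 2) * conj (gaussFun q (x - y / 2))) := by
  rw [crossWigner]
  congr 1
  refine integral_congr_ae ?_
  have hadd : Measure.QuasiMeasurePreserving (fun y : ℝ => x + y / 2) volume volume := by
    refine (measurePreserving_add_left volume x).quasiMeasurePreserving.comp ?_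
    have := Measure.quasiMeasurePreserving_smul (volume : Measure ℝ)
      (one_div_ne_zero (two_ne_zero' ℝ))
    convert this using 2 with y
    rw [smul_eq_mul]
    ring
  have hsub : Measure.QuasiMeasurePreserving (fun y : ℝ => x - y / 2) volume volume := by
    have := hadd.comp (Measure.measurePreserving_neg (volume : Measure ℝ)).quasiMeasurePreserving
    convert this using 2 with y
    simp
    ring
  filter_upwards [hadd.ae (coeFn_polyGauss p), hsub.ae (coeFn_polyGauss q)] with y h1 h2
  rw [h1, h2, mul_assoc]

/-- The integral `∫ p(z̄ + t) q̄(z - t) exp(-t²) dt`: up to the factor `π⁻¹ exp(-|z|²)`, the Wigner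
function at `z = x + iξ` of the functions `p` and `q` times the Gaussian. -/
def wignerPoly (p q : ℂ[X]) (z : ℂ) : ℂ :=
  ∫ t : ℝ, p.eval (conj z + t) * (q.map (starRingEnd ℂ)).eval (z - t) * Complex.exp (-(t : ℂ) ^ 2)

theorem crossWigner_polyGauss (p q : ℂ[X]) (x ξ : ℝ) :
    crossWigner (polyGauss p) (polyGauss q) x ξ =
      (1 / Real.pi * Real.exp (-x ^ 2 - ξ ^ 2) : ℝ) * wignerPoly p q (x + ξ * Complex.I) := by
  set z : ℂ := x + ξ * Complex.I with hz
  have hzc : conj z = x - ξ * Complex.I := by simp [hz, sub_eq_add_neg]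
  set f : ℂ[X] := p.comp (X + C (conj z)) * (q.map (starRingEnd ℂ)).comp (C z - X) with hf
  have h1 : wignerPoly p q z = ∫ t : ℝ, f.eval (t : ℂ) * Complex.exp (-(t : ℂ) ^ 2) := by
    simp only [wignerPoly, hf, eval_mul, eval_comp, eval_add, eval_sub, eval_X, eval_C]
    simp_rw [add_comm (conj z)]
  rw [crossWigner_polyGauss_eq_integral, h1, ← integral_eval_mul_cexp_shift f ξ,
    ← integral_const_mul, ← integral_const_mul]
  have h2 := Measure.integral_comp_mul_left (fun y : ℝ => (1 / (2 * Real.pi : ℝ) : ℂ) *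
    (Complex.exp (-(Complex.I * ξ * y)) *
        (gaussFun p (x + y / 2) * conj (gaussFun q (x - y / 2))))) 2
  rw [abs_of_pos (by norm_num), eq_inv_smul_iff₀ (by norm_num)] at h2
  rw [← h2, ← integral_smul]
  refine integral_congr_ae (Eventually.of_forall fun t => ?_)
  simp only [conj_gaussFun, hf, eval_mul, eval_comp, eval_add, eval_sub, eval_X, eval_C, hzc]
  have e1 : x + 2 * t / 2 = x + t := by ring
  have e2 : x - 2 * t / 2 = x - t := by ring
  have e3 : ((t : ℂ) + ξ * Complex.I + (x - ξ * Complex.I)) = ((x + t : ℝ) : ℂ) := by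
    push_cast; ring
  have e4 : z - ((t : ℂ) + ξ * Complex.I) = ((x - t : ℝ) : ℂ) := by
    rw [hz]; push_cast; ring
  rw [e1, e2, e3, e4, gaussFun, gaussFun]
  have e5 : Complex.exp (-(Complex.I * ξ * (2 * t : ℝ))) *
      (Complex.exp (-((x + t : ℝ) : ℂ) ^ 2 / 2) * Complex.exp (-((x - t : ℝ) : ℂ) ^ 2 / 2))
      = (Real.exp (-x ^ 2 - ξ ^ 2) : ℝ) * Complex.exp (-((t : ℂ) + ξ * Complex.I) ^ 2) := by
    rw [Complex.ofReal_exp, ← Complex.exp_add, ← Complex.exp_add, ← Complex.exp_add]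
    congr 1
    push_cast
    linear_combination ((ξ : ℂ) ^ 2) * Complex.I_sq
  simp only [Complex.real_smul]
  push_cast at e5 ⊢
  linear_combination ((Real.pi : ℂ)⁻¹ * (eval ((x : ℂ) + t) p) *
    (eval ((x : ℂ) - t) (Polynomial.map (starRingEnd ℂ) q))) * e5

theorem integrable_wignerPoly (p q : ℂ[X]) (z : ℂ) :
    Integrable fun t : ℝ => p.eval (conj z + t) * (q.map (starRingEnd ℂ)).eval (z - t) *
      Complex.exp (-(t : ℂ) ^ 2) := by
  have := integrable_eval_mul_cexp
    (p.comp (X + C (conj z)) * (q.map (starRingEnd ℂ)).comp (C z - X))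
  simpa [add_comm (conj z)] using this

/-- `wignerPoly` as a sesquilinear form in the two polynomials. -/
def wignerForm (z : ℂ) : ℂ[X] →ₗ[ℂ] ℂ[X] →ₗ⋆[ℂ] ℂ :=
  LinearMap.mk₂'ₛₗ (RingHom.id ℂ) (starRingEnd ℂ) (fun p q => wignerPoly p q z)
    (fun p p' q => by
      simp only [wignerPoly, eval_add, add_mul]
      exact integral_add (integrable_wignerPoly p q z) (integrable_wignerPoly p' q z))
    (fun a p q => by
      simp only [wignerPoly, eval_smul, smul_eq_mul, mul_assoc, RingHom.id_apply]
      exact integral_const_mul _ _)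
    (fun p q q' => by
      simp only [wignerPoly, Polynomial.map_add, eval_add, add_mul, mul_add]
      exact integral_add (integrable_wignerPoly p q z) (integrable_wignerPoly p q' z))
    (fun a p q => by
      simp only [wignerPoly, Polynomial.map_smul, eval_smul, smul_eq_mul]
      rw [← integral_const_mul]
      congr 1
      ext t
      ring)

theorem wignerForm_apply (z : ℂ) (p q : ℂ[X]) : wignerForm z p q = wignerPoly p q z := rfl

theorem natDegree_map_conj (p : ℂ[X]) : (p.map (starRingEnd ℂ)).natDegree = p.natDegree :=
  natDegree_map _

theorem exists_norm_wignerPoly_integrand_le (p q : ℂ[X]) {n : ℕ} (hp : p.natDegree ≤ n)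
    (hq : q.natDegree ≤ n) :
    ∃ C : ℝ, 0 ≤ C ∧ ∀ (z : ℂ) (t : ℝ),
      ‖p.eval (conj z + t) * (q.map (starRingEnd ℂ)).eval (z - t) * Complex.exp (-(t : ℂ) ^ 2)‖ ≤
        C * (1 + ‖z‖) ^ (2 * n) * ((1 + |t|) ^ (2 * n) * Real.exp (-t ^ 2)) := by
  obtain ⟨C₁, hC₁, h₁⟩ := exists_norm_eval_le p hp
  obtain ⟨C₂, hC₂, h₂⟩ := exists_norm_eval_le (q.map (starRingEnd ℂ))
    ((natDegree_map_conj q).trans_le hq)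
  refine ⟨C₁ * C₂, by positivity, fun z t => ?_⟩
  rw [norm_mul, norm_mul, norm_cexp_neg_sq]
  have e : ∀ w : ℂ, ‖w‖ ≤ ‖z‖ + |t| → (1 + ‖w‖) ^ n ≤ ((1 + ‖z‖) * (1 + |t|)) ^ n := by
    intro w hw
    gcongr
    nlinarith [norm_nonneg z, abs_nonneg t, mul_nonneg (norm_nonneg z) (abs_nonneg t)]
  have e1 := e (conj z + t) ((norm_add_le _ _).trans (by simp))
  have e2 := e (z - t) ((norm_sub_le _ _).trans (by simp))
  calc _ ≤ (C₁ * ((1 + ‖z‖) * (1 + |t|)) ^ n) * (C₂ * ((1 + ‖z‖) * (1 + |t|)) ^ n)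
        * Real.exp (-t ^ 2) := by
        gcongr
        · exact (h₁ _).trans (by gcongr)
        · exact (h₂ _).trans (by gcongr)
    _ = _ := by rw [mul_pow]; ring

theorem exists_norm_wignerPoly_le (p q : ℂ[X]) {n : ℕ} (hp : p.natDegree ≤ n)
    (hq : q.natDegree ≤ n) :
    ∃ C : ℝ, 0 ≤ C ∧ ∀ z : ℂ, ‖wignerPoly p q z‖ ≤ C * (1 + ‖z‖ ^ 2) ^ n := by
  obtain ⟨C, hC, h⟩ := exists_norm_wignerPoly_integrand_le p q hp hq
  set K := ∫ t : ℝ, (1 + |t|) ^ (2 * n) * Real.exp (-t ^ 2)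
  have hK : 0 ≤ K := integral_nonneg fun t => by positivity
  refine ⟨C * 2 ^ n * K, by positivity, fun z => ?_⟩
  have h1 := norm_integral_le_of_norm_le
    ((integrable_one_add_abs_pow_mul_exp_neg_sq (2 * n)).const_mul (C * (1 + ‖z‖) ^ (2 * n)))
    (Eventually.of_forall (h z))
  rw [integral_const_mul] at h1
  refine h1.trans ?_
  have h2 : (1 + ‖z‖) ^ (2 * n) ≤ 2 ^ n * (1 + ‖z‖ ^ 2) ^ n := by
    rw [pow_mul, ← mul_pow]
    gcongr
    nlinarith [sq_nonneg (1 - ‖z‖)]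
  calc C * (1 + ‖z‖) ^ (2 * n) * K ≤ C * (2 ^ n * (1 + ‖z‖ ^ 2) ^ n) * K := by gcongr
    _ = _ := by ring

theorem tendsto_eval_div_pow (p : ℂ[X]) {n : ℕ} (hp : p.natDegree ≤ n) :
    Tendsto (fun w : ℂ => p.eval w / w ^ n) (comap norm atTop) (𝓝 (p.coeff n)) := by
  have hinv : Tendsto (fun w : ℂ => w⁻¹) (comap norm atTop) (𝓝 0) := by
    rw [comap_norm_atTop]; exact tendsto_inv₀_cobounded
  have hne : ∀ᶠ w : ℂ in comap norm atTop, w ≠ 0 := by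
    filter_upwards [tendsto_comap.eventually (eventually_gt_atTop (0 : ℝ))] with w hw
    exact norm_pos_iff.1 hw
  have h1 : Tendsto (fun w : ℂ => ∑ k ∈ Finset.range (n + 1), p.coeff k * w⁻¹ ^ (n - k))
      (comap norm atTop) (𝓝 (∑ k ∈ Finset.range (n + 1), p.coeff k * 0 ^ (n - k))) :=
    tendsto_finsetSum _ fun k _ => (hinv.pow _).const_mul _
  have h2 : ∑ k ∈ Finset.range (n + 1), p.coeff k * (0 : ℂ) ^ (n - k) = p.coeff n := by
    rw [Finset.sum_range_succ, Finset.sum_eq_zero]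
    · simp
    · intro k hk
      rw [zero_pow (Nat.sub_ne_zero_of_lt (Finset.mem_range.1 hk)), mul_zero]
  rw [h2] at h1
  refine h1.congr' ?_
  filter_upwards [hne] with w hw
  rw [p.eval_eq_sum_range' (Nat.lt_succ_of_le hp), Finset.sum_div]
  refine Finset.sum_congr rfl fun k hk => ?_
  rw [mul_div_assoc, ← pow_sub_mul_pow w (Finset.mem_range_succ_iff.1 hk), inv_pow,
    div_mul_cancel_right₀ (pow_ne_zero _ hw)]

theorem tendsto_eval_add_div_pow (p : ℂ[X]) (s : ℂ) :
    Tendsto (fun w : ℂ => p.eval (w + s) / w ^ p.natDegree) (comap norm atTop)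
      (𝓝 p.leadingCoeff) := by
  have := tendsto_eval_div_pow (taylor s p) (natDegree_taylor p s).le
  rw [coeff_taylor_natDegree] at this
  refine this.congr fun w => ?_
  rw [taylor_eval, add_comm]

theorem tendsto_wignerPoly_self_div_pow (p : ℂ[X]) :
    Tendsto (fun z : ℂ => wignerPoly p p z / (‖z‖ ^ (2 * p.natDegree) : ℝ)) (comap norm atTop)
      (𝓝 ((‖p.leadingCoeff‖ ^ 2 * √Real.pi : ℝ) : ℂ)) := by
  obtain ⟨C, hC, h⟩ := exists_norm_wignerPoly_integrand_le p p le_rfl le_rfl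
  set n := p.natDegree with hn
  have hlim : ((‖p.leadingCoeff‖ ^ 2 * √Real.pi : ℝ) : ℂ)
      = ∫ t : ℝ, p.leadingCoeff * conj p.leadingCoeff * Complex.exp (-(t : ℂ) ^ 2) := by
    have := integral_shift_pow_zero 0
    simp only [pow_zero, one_mul, Complex.ofReal_zero, zero_mul, add_zero] at this
    rw [integral_const_mul, this, Complex.mul_conj, Complex.normSq_eq_norm_sq]
    push_cast
    rfl
  simp only [wignerPoly, ← integral_div]
  rw [hlim]
  have hge : ∀ᶠ z : ℂ in comap norm atTop, 1 ≤ ‖z‖ :=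
    tendsto_comap.eventually (eventually_ge_atTop (1 : ℝ))
  refine tendsto_integral_filter_of_dominated_convergence
    (fun t => C * 2 ^ (2 * n) * ((1 + |t|) ^ (2 * n) * Real.exp (-t ^ 2))) ?_ ?_ ?_ ?_
  · exact Eventually.of_forall fun z => (by fun_prop : Continuous _).aestronglyMeasurable
  · filter_upwards [hge] with z hz
    refine Eventually.of_forall fun t => ?_
    have hz0 : 0 < ‖z‖ ^ (2 * n) := by positivity
    rw [norm_div, Complex.norm_real, Real.norm_of_nonneg hz0.le, div_le_iff₀ hz0]
    refine (h z t).trans ?_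
    have : (1 + ‖z‖) ^ (2 * n) ≤ 2 ^ (2 * n) * ‖z‖ ^ (2 * n) := by
      rw [← mul_pow]
      gcongr
      linarith
    calc C * (1 + ‖z‖) ^ (2 * n) * ((1 + |t|) ^ (2 * n) * Real.exp (-t ^ 2))
        ≤ C * (2 ^ (2 * n) * ‖z‖ ^ (2 * n)) * ((1 + |t|) ^ (2 * n) * Real.exp (-t ^ 2)) := by
          gcongr
      _ = _ := by ring
  · exact (integrable_one_add_abs_pow_mul_exp_neg_sq (2 * n)).const_mul _
  · refine Eventually.of_forall fun t => ?_
    have hconj : Tendsto (fun z : ℂ => conj z) (comap norm atTop) (comap norm atTop) := by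
      refine tendsto_comap_iff.2 ?_
      simpa [Function.comp_def] using tendsto_norm_cobounded_atTop (E := ℂ)
    have h1 := (tendsto_eval_add_div_pow p (t : ℂ)).comp hconj
    have h2 := tendsto_eval_add_div_pow (p.map (starRingEnd ℂ)) (-(t : ℂ))
    rw [natDegree_map_conj, leadingCoeff_map] at h2
    refine ((h1.mul h2).mul_const _).congr fun z => ?_
    have e : ((‖z‖ ^ (2 * n) : ℝ) : ℂ) = conj z ^ n * z ^ n := by
      rw [← mul_pow, mul_comm (conj z), Complex.mul_conj, Complex.normSq_eq_norm_sq, pow_mul]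
      push_cast
      rfl
    rw [e]
    simp only [Function.comp, ← sub_eq_add_neg, ← hn]
    ring

/-- The Wigner function of a polynomial of degree `n` times the Gaussian is bounded below by a
positive multiple of `(1 + |z|²)ⁿ exp(-|z|²)`, up to a multiple of `exp(-|z|²)`. -/
theorem exists_le_re_wignerPoly_self {p : ℂ[X]} (hp : p ≠ 0) :
    ∃ δ M : ℝ, 0 < δ ∧ 0 ≤ M ∧ ∀ z : ℂ,
      δ * (1 + ‖z‖ ^ 2) ^ p.natDegree - M ≤ (wignerPoly p p z).re := by
  set n := p.natDegree
  set L : ℝ := ‖p.leadingCoeff‖ ^ 2 * √Real.pi with hL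
  have hLpos : 0 < L := by
    have : 0 < ‖p.leadingCoeff‖ := norm_pos_iff.2 (leadingCoeff_ne_zero.2 hp)
    have := Real.sqrt_pos.2 Real.pi_pos
    positivity
  have h1 := (Complex.continuous_re.tendsto _).comp (tendsto_wignerPoly_self_div_pow p)
  have h2 : ∀ᶠ z : ℂ in comap norm atTop,
      L / 2 < (wignerPoly p p z / (‖z‖ ^ (2 * n) : ℝ)).re :=
    h1.eventually_const_lt (by simp only [Complex.ofReal_re]; linarith)
  have h3 := h2.and (tendsto_comap.eventually (eventually_ge_atTop (1 : ℝ)))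
  rw [eventually_comap, eventually_atTop] at h3
  obtain ⟨R, hR⟩ := h3
  obtain ⟨C, hC, hbound⟩ := exists_norm_wignerPoly_le p p (n := n) le_rfl le_rfl
  set δ := L / 2 / 2 ^ n
  have hδ : 0 < δ := by positivity
  refine ⟨δ, (C + δ) * (1 + R ^ 2) ^ n, hδ, by positivity, fun z => ?_⟩
  rcases le_or_gt R ‖z‖ with hz | hz
  · obtain ⟨h4, h5⟩ := hR _ hz z rfl
    have hz0 : 0 < ‖z‖ ^ (2 * n) := by positivity
    rw [Complex.div_ofReal_re, lt_div_iff₀ hz0] at h4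
    have h6 : (1 + ‖z‖ ^ 2) ^ n ≤ 2 ^ n * ‖z‖ ^ (2 * n) := by
      rw [pow_mul, ← mul_pow]
      gcongr
      nlinarith
    have h7 : δ * (1 + ‖z‖ ^ 2) ^ n ≤ L / 2 * ‖z‖ ^ (2 * n) := by
      calc _ ≤ δ * (2 ^ n * ‖z‖ ^ (2 * n)) := by gcongr
        _ = _ := by simp only [δ]; field_simp
    have : 0 ≤ (C + δ) * (1 + R ^ 2) ^ n := by positivity
    linarith
  · have h4 := (abs_le.1 ((Complex.abs_re_le_norm _).trans (hbound z))).1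
    have h5 : (1 + ‖z‖ ^ 2) ^ n ≤ (1 + R ^ 2) ^ n := by gcongr
    nlinarith

theorem wignerPoly_one_one (z : ℂ) : wignerPoly 1 1 z = (√Real.pi : ℝ) := by
  simpa [wignerPoly] using integral_shift_pow_zero 0

/-! ### Trace and trace norm in finite dimension -/

section FiniteDimensional

variable {E : Type*} [NormedAddCommGroup E] [InnerProductSpace ℂ E] [CompleteSpace E]

theorem absOp_mul_self (T : E →L[ℂ] E) :
    absOp T * absOp T = ContinuousLinearMap.adjoint T * T :=
  CFC.sqrt_mul_sqrt_self _ ((ContinuousLinearMap.nonneg_iff_isPositive _).2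
    (ContinuousLinearMap.isPositive_adjoint_comp_self T))

theorem absOp_nonneg (T : E →L[ℂ] E) : 0 ≤ absOp T := CFC.sqrt_nonneg _

theorem norm_absOp (T : E →L[ℂ] E) : ‖absOp T‖ = ‖T‖ := by
  have h1 : ‖absOp T * absOp T‖ = ‖absOp T‖ * ‖absOp T‖ := by
    have := CStarRing.norm_star_mul_self (x := absOp T)
    rwa [(absOp_nonneg T).isSelfAdjoint.star_eq] at this
  have h2 : ‖ContinuousLinearMap.adjoint T * T‖ = ‖T‖ * ‖T‖ :=
    ContinuousLinearMap.norm_adjoint_comp_self T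
  rw [absOp_mul_self, h2] at h1
  exact ((mul_self_inj (norm_nonneg _) (norm_nonneg _)).1 h1).symm

theorem norm_basis (i : BasisIndex E) : ‖basis E i‖ = 1 := (basis E).orthonormal.1 i

/-- A self-adjoint operator close to one that is bounded below by `c > 0` is positive. -/
theorem isPositive_of_norm_sub_le {S T : E →L[ℂ] E} {c : ℝ} (hT : IsSelfAdjoint T)
    (hS : ∀ x, c * ‖x‖ ^ 2 ≤ (inner ℂ (S x) x).re) (h : ‖T - S‖ ≤ c) : T.IsPositive := by
  refine ContinuousLinearMap.isPositive_def'.2 ⟨hT, fun x => ?_⟩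
  have h1 : T x = S x + (T - S) x := by simp
  have h2 : |(inner ℂ ((T - S) x) x).re| ≤ c * ‖x‖ ^ 2 := by
    refine (Complex.abs_re_le_norm _).trans ((norm_inner_le_norm _ _).trans ?_)
    rw [sq, ← mul_assoc]
    gcongr
    exact ((T - S).le_opNorm x).trans (by gcongr)
  rw [ContinuousLinearMap.reApplyInnerSelf_apply, h1, inner_add_left, map_add]
  have := (abs_le.1 h2).1
  have := hS x
  simp only [RCLike.re_to_complex]
  linarith

theorem norm_inner_basis_le (T : E →L[ℂ] E) (i j : BasisIndex E) :
    ‖inner ℂ (basis E j) (T (basis E i))‖ ≤ ‖T‖ := by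
  refine (norm_inner_le_norm _ _).trans ?_
  simpa [norm_basis] using T.le_opNorm (basis E i)

variable [FiniteDimensional ℂ E]

instance finite_basisIndex : Finite (BasisIndex E) :=
  (basis E).orthonormal.linearIndependent.finite

instance fintypeBasisIndex : Fintype (BasisIndex E) := Fintype.ofFinite _

variable (E) in
/-- The chosen Hilbert basis of a finite-dimensional space, as an orthonormal basis. -/
def onb : OrthonormalBasis (BasisIndex E) ℂ E := (basis E).toOrthonormalBasis

@[simp] theorem onb_apply (i : BasisIndex E) : onb E i = basis E i := by
  simp [onb]

theorem sum_inner_smul_basis (x : E) : ∑ i, inner ℂ (basis E i) x • basis E i = x := by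
  simpa using (onb E).sum_repr' x

theorem isTraceClass_of_finiteDimensional (T : E →L[ℂ] E) : IsTraceClass T :=
  (hasSum_fintype _).summable

theorem trace_eq_sum (T : E →L[ℂ] E) : trace T = ∑ i, inner ℂ (basis E i) (T (basis E i)) :=
  tsum_fintype _

theorem trace_add (S T : E →L[ℂ] E) : trace (S + T) = trace S + trace T := by
  simp [trace_eq_sum, Finset.sum_add_distrib]

theorem trace_smul (a : ℂ) (T : E →L[ℂ] E) : trace (a • T) = a * trace T := by
  simp [trace_eq_sum, Finset.mul_sum]

theorem trace_sub (S T : E →L[ℂ] E) : trace (S - T) = trace S - trace T := by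
  simp [trace_eq_sum, Finset.sum_sub_distrib]

theorem traceNorm_le (T : E →L[ℂ] E) : traceNorm T ≤ Fintype.card (BasisIndex E) * ‖T‖ := by
  rw [traceNorm, trace_eq_sum, Complex.re_sum, ← nsmul_eq_mul]
  refine Finset.sum_le_card_nsmul _ _ _ fun i _ => ?_
  rw [← norm_absOp T]
  exact (Complex.re_le_norm _).trans (norm_inner_basis_le _ i i)

/-- The operator norm is at most the trace norm: with `S = |T|^{1/2}` one has
`‖T‖ = ‖S‖² ≤ ∑ᵢ ‖S eᵢ‖² = tr |T|`. -/
theorem norm_le_traceNorm (T : E →L[ℂ] E) : ‖T‖ ≤ traceNorm T := by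
  set S := CFC.sqrt (absOp T)
  have hS : S * S = absOp T := CFC.sqrt_mul_sqrt_self _ (absOp_nonneg T)
  have hSa : IsSelfAdjoint S := (CFC.sqrt_nonneg (absOp T)).isSelfAdjoint
  have h1 : ‖absOp T‖ = ‖S‖ * ‖S‖ := by
    rw [← CStarRing.norm_star_mul_self (x := S), hSa.star_eq, hS]
  have h2 : traceNorm T = ∑ i, ‖S (basis E i)‖ ^ 2 := by
    rw [traceNorm, trace_eq_sum, Complex.re_sum]
    refine Finset.sum_congr rfl fun i _ => ?_
    have h4 : inner ℂ (basis E i) (S (S (basis E i))) = inner ℂ (S (basis E i)) (S (basis E i)) :=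
      ((ContinuousLinearMap.isSelfAdjoint_iff_isSymmetric.1 hSa) (basis E i) (S (basis E i))).symm
    rw [← hS, mul_apply_eq_comp, h4]
    exact inner_self_eq_norm_sq (𝕜 := ℂ) _
  have h3 : ‖S‖ ≤ √(∑ i, ‖S (basis E i)‖ ^ 2) := by
    refine S.opNorm_le_bound (Real.sqrt_nonneg _) fun x => ?_
    conv_lhs => rw [← sum_inner_smul_basis x, map_sum]
    refine (norm_sum_le _ _).trans ?_
    simp only [map_smul, norm_smul]
    refine (Real.sum_mul_le_sqrt_mul_sqrt _ _ _).trans ?_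
    rw [mul_comm]
    have := (onb E).sum_sq_norm_inner_right x
    simp only [onb_apply] at this
    rw [this, Real.sqrt_sq (norm_nonneg _)]
  rw [← norm_absOp T, h1, h2, ← sq]
  exact (Real.le_sqrt (norm_nonneg _) (by positivity)).1 h3

theorem trace_eq_ofReal_re_of_isSelfAdjoint {T : E →L[ℂ] E} (hT : IsSelfAdjoint T) :
    trace T = ((trace T).re : ℂ) := by
  refine (Complex.conj_eq_iff_re.1 ?_).symm
  rw [trace_eq_sum, map_sum]
  refine Finset.sum_congr rfl fun i _ => ?_
  rw [inner_conj_symm]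
  exact (ContinuousLinearMap.isSelfAdjoint_iff_isSymmetric.1 hT) _ _

theorem card_mul_le_re_trace {T : E →L[ℂ] E} {c : ℝ}
    (hT : ∀ x, c * ‖x‖ ^ 2 ≤ (inner ℂ (T x) x).re) :
    Fintype.card (BasisIndex E) * c ≤ (trace T).re := by
  rw [trace_eq_sum, Complex.re_sum, ← nsmul_eq_mul]
  refine Finset.card_nsmul_le_sum _ _ _ fun i _ => ?_
  have h1 := hT (basis E i)
  rwa [norm_basis, one_pow, mul_one, ← inner_conj_symm, Complex.conj_re] at h1

/-! ### The affine hull of a set with interior -/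

variable (E) in
/-- The operators of unit trace as an affine subspace. -/
def unitTraceSubspace : AffineSubspace ℝ (E →L[ℂ] E) where
  carrier := unitTrace E
  smul_vsub_vadd_mem' c p₁ p₂ p₃ h₁ h₂ h₃ := by
    refine ⟨isTraceClass_of_finiteDimensional _, ?_, ?_⟩
    · exact ((IsSelfAdjoint.all c).smul (h₁.2.1.sub h₂.2.1)).add h₃.2.1
    · rw [vsub_eq_sub, vadd_eq_add, ← Complex.coe_smul, trace_add, trace_smul, trace_sub,
        h₁.2.2, h₂.2.2, h₃.2.2]
      simp

theorem affHull_subset_unitTrace {S : Set (E →L[ℂ] E)} (hS : S ⊆ unitTrace E) :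
    affHull S ⊆ unitTrace E :=
  affineSpan_le (Q := unitTraceSubspace E).2 hS

/-- A set of operators of unit trace with an interior point spans all of them: every operator
is on a line through the interior point, and near that point the line stays in the set. -/
theorem affHull_eq_unitTrace {S : Set (E →L[ℂ] E)} (hS : S ⊆ unitTrace E)
    (h : (relInterior (unitTrace E) S).Nonempty) : affHull S = unitTrace E := by
  refine (affHull_subset_unitTrace hS).antisymm fun σ hσ => ?_
  obtain ⟨ρ, hρ, ε, hε, hball⟩ := h
  set K : ℝ := Fintype.card (BasisIndex E) * ‖σ - ρ‖ + 1
  have hK : 0 < K := by positivity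
  set t : ℝ := ε / K
  have ht : 0 < t := by positivity
  have hmem : t • (σ - ρ) + ρ ∈ unitTrace E :=
    (unitTraceSubspace E).smul_vsub_vadd_mem t hσ hρ hρ
  have hρS : ρ ∈ S := hball ρ hρ (by
    refine (traceNorm_le _).trans_lt ?_
    simpa using hε)
  have hS' : t • (σ - ρ) + ρ ∈ S := by
    refine hball _ hmem ((traceNorm_le _).trans_lt ?_)
    rw [add_sub_cancel_right, norm_smul, Real.norm_of_nonneg ht.le]
    have : t * K = ε := div_mul_cancel₀ _ hK.ne'
    nlinarith
  have h1 := (affineSpan ℝ S).smul_vsub_vadd_mem t⁻¹ (subset_affineSpan ℝ S hS')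
    (subset_affineSpan ℝ S hρS) (subset_affineSpan ℝ S hρS)
  rwa [vsub_eq_sub, vadd_eq_add, add_sub_cancel_right, smul_smul, inv_mul_cancel₀ ht.ne',
    one_smul, sub_add_cancel] at h1

end FiniteDimensional

/-! ### Wigner functions of operators on spaces of finite Fock rank -/

instance finiteDimensional_fockSpan (N : ℕ) : FiniteDimensional ℂ (fockSpan N) := by
  have : {ψ : L2 | ∃ n ≤ N, ψ = fock n} = fock '' Set.Iic N := by
    ext ψ
    simp [eq_comm]
  rw [fockSpan, this]
  exact FiniteDimensional.span_of_finite ℂ ((Set.finite_Iic N).image _)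

theorem fockSpan_le_range (N : ℕ) : fockSpan N ≤ LinearMap.range polyGauss := by
  intro ψ hψ
  obtain ⟨p, -, rfl⟩ := mem_fockSpan_iff.1 hψ
  exact ⟨p, rfl⟩

/-- The function `(1 + |z|²)ᴺ exp(-|z|²)` of `z = x + iξ`, which bounds every Wigner function of an
operator on `ℋᴺ`. -/
def wignerEnvelope (N : ℕ) (x ξ : ℝ) : ℝ := (1 + x ^ 2 + ξ ^ 2) ^ N * Real.exp (-x ^ 2 - ξ ^ 2)

theorem wignerEnvelope_pos (N : ℕ) (x ξ : ℝ) : 0 < wignerEnvelope N x ξ := by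
  unfold wignerEnvelope; positivity

theorem norm_add_mul_I_sq (x ξ : ℝ) : ‖(x : ℂ) + ξ * Complex.I‖ ^ 2 = x ^ 2 + ξ ^ 2 := by
  rw [← Complex.normSq_eq_norm_sq, Complex.normSq_add_mul_I]

theorem exists_norm_crossWigner_le {N : ℕ} {ψ φ : L2} (hψ : ψ ∈ fockSpan N)
    (hφ : φ ∈ fockSpan N) :
    ∃ C : ℝ, 0 ≤ C ∧ ∀ x ξ : ℝ, ‖crossWigner ψ φ x ξ‖ ≤ C * wignerEnvelope N x ξ := by
  obtain ⟨p, hp, rfl⟩ := mem_fockSpan_iff.1 hψ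
  obtain ⟨q, hq, rfl⟩ := mem_fockSpan_iff.1 hφ
  obtain ⟨C, hC, h⟩ := exists_norm_wignerPoly_le p q hp hq
  have hpi := Real.pi_pos
  refine ⟨1 / Real.pi * C, by positivity, fun x ξ => ?_⟩
  have h1 := h (x + ξ * Complex.I)
  rw [norm_add_mul_I_sq, ← add_assoc] at h1
  rw [crossWigner_polyGauss, norm_mul, Complex.norm_real, Real.norm_of_nonneg (by positivity),
    wignerEnvelope]
  calc _ ≤ 1 / Real.pi * Real.exp (-x ^ 2 - ξ ^ 2) * (C * (1 + x ^ 2 + ξ ^ 2) ^ N) := by gcongr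
    _ = _ := by ring

theorem isSelfAdjoint_ofReal (a : ℝ) : IsSelfAdjoint (a : ℂ) := Complex.conj_ofReal a

section Operators

variable {H : Submodule ℂ L2}

/-- The cross-Wigner function at a point, as a sesquilinear form on a space of polynomials
times the Gaussian. -/
def wignerSesq (hH : H ≤ LinearMap.range polyGauss) (x ξ : ℝ) : H →ₗ[ℂ] H →ₗ⋆[ℂ] ℂ :=
  LinearMap.mk₂'ₛₗ (RingHom.id ℂ) (starRingEnd ℂ) (fun ψ φ => crossWigner ψ φ x ξ)
    (fun ψ ψ' φ => by
      obtain ⟨p, hp⟩ := hH ψ.2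
      obtain ⟨p', hp'⟩ := hH ψ'.2
      obtain ⟨q, hq⟩ := hH φ.2
      simp only [Submodule.coe_add, ← hp, ← hp', ← hq, ← map_add, crossWigner_polyGauss,
        ← wignerForm_apply]
      rw [map_add, LinearMap.add_apply, mul_add])
    (fun a ψ φ => by
      obtain ⟨p, hp⟩ := hH ψ.2
      obtain ⟨q, hq⟩ := hH φ.2
      simp only [Submodule.coe_smul, ← hp, ← hq, ← map_smul, crossWigner_polyGauss,
        ← wignerForm_apply, RingHom.id_apply]
      rw [map_smul, LinearMap.smul_apply, smul_eq_mul, smul_eq_mul]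
      ring)
    (fun ψ φ φ' => by
      obtain ⟨p, hp⟩ := hH ψ.2
      obtain ⟨q, hq⟩ := hH φ.2
      obtain ⟨q', hq'⟩ := hH φ'.2
      simp only [Submodule.coe_add, ← hp, ← hq', ← hq, ← map_add, crossWigner_polyGauss,
        ← wignerForm_apply]
      rw [map_add, mul_add])
    (fun a ψ φ => by
      obtain ⟨p, hp⟩ := hH ψ.2
      obtain ⟨q, hq⟩ := hH φ.2
      simp only [Submodule.coe_smul, ← hp, ← hq, ← map_smul, crossWigner_polyGauss,
        ← wignerForm_apply]
      rw [LinearMap.map_smulₛₗ, smul_eq_mul, smul_eq_mul]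
      ring)

theorem wignerSesq_apply (hH : H ≤ LinearMap.range polyGauss) (x ξ : ℝ) (ψ φ : H) :
    wignerSesq hH x ξ ψ φ = crossWigner ψ φ x ξ := rfl

variable [CompleteSpace H] [FiniteDimensional ℂ H]

theorem wigner_eq_sum (hH : H ≤ LinearMap.range polyGauss) (T : H →L[ℂ] H) (x ξ : ℝ) :
    wigner T x ξ = ∑ i, wignerSesq hH x ξ (T (basis H i)) (basis H i) := by
  simp only [wigner, tsum_fintype, wignerSesq_apply]

theorem wigner_add (hH : H ≤ LinearMap.range polyGauss) (S T : H →L[ℂ] H) (x ξ : ℝ) :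
    wigner (S + T) x ξ = wigner S x ξ + wigner T x ξ := by
  simp [wigner_eq_sum hH, Finset.sum_add_distrib]

theorem wigner_smul (hH : H ≤ LinearMap.range polyGauss) (a : ℂ) (T : H →L[ℂ] H) (x ξ : ℝ) :
    wigner (a • T) x ξ = a * wigner T x ξ := by
  simp [wigner_eq_sum hH, Finset.mul_sum]

/-- The Wigner function of `|ψ⟩⟨φ|` is the cross-Wigner function of `ψ` and `φ`. -/
theorem wigner_rankOne (hH : H ≤ LinearMap.range polyGauss) (ψ φ : H) (x ξ : ℝ) :
    wigner (rankOne ℂ ψ φ) x ξ = crossWigner ψ φ x ξ := by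
  rw [wigner_eq_sum hH, ← wignerSesq_apply hH]
  conv_rhs => rw [← sum_inner_smul_basis φ, map_sum]
  refine Finset.sum_congr rfl fun i _ => ?_
  rw [rankOne_apply, map_smul, LinearMap.smul_apply, LinearMap.map_smulₛₗ]
  exact congrArg (· • _) (inner_conj_symm (𝕜 := ℂ) (E := H) _ _).symm

theorem exists_norm_wigner_le {N : ℕ} (hH : H ≤ fockSpan N) :
    ∃ C : ℝ, 0 ≤ C ∧ ∀ (T : H →L[ℂ] H) (x ξ : ℝ),
      ‖wigner T x ξ‖ ≤ C * ‖T‖ * wignerEnvelope N x ξ := by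
  have hR := hH.trans (fockSpan_le_range N)
  choose C hC h using fun i j : BasisIndex H =>
    exists_norm_crossWigner_le (hH (basis H j).2) (hH (basis H i).2)
  refine ⟨∑ i, ∑ j, C i j, Finset.sum_nonneg fun i _ => Finset.sum_nonneg fun j _ => hC i j,
    fun T x ξ => ?_⟩
  rw [wigner_eq_sum hR, Finset.sum_mul, Finset.sum_mul]
  refine (norm_sum_le _ _).trans (Finset.sum_le_sum fun i _ => ?_)
  rw [Finset.sum_mul, Finset.sum_mul]
  conv_lhs => rw [← sum_inner_smul_basis (T (basis H i)), map_sum, LinearMap.sum_apply]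
  refine (norm_sum_le _ _).trans (Finset.sum_le_sum fun j _ => ?_)
  rw [map_smul, LinearMap.smul_apply, smul_eq_mul, norm_mul, wignerSesq_apply]
  calc _ ≤ ‖T‖ * (C i j * wignerEnvelope N x ξ) := by
        exact mul_le_mul (norm_inner_basis_le T i j) (h i j x ξ) (norm_nonneg _)
          T.opNorm_nonneg
    _ = _ := by ring

/-- A positive operator whose Wigner function is at least a multiple of the envelope yields an
interior Wigner-positive state: add a small multiple of the identity and normalize. -/
theorem relInterior_wignerPositive_nonempty {N : ℕ} (hH : H ≤ fockSpan N) {B : H →L[ℂ] H}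
    (hB : B.IsPositive) {δ : ℝ} (hδ : 0 < δ)
    (hW : ∀ x ξ : ℝ, δ * wignerEnvelope N x ξ ≤ (wigner B x ξ).re) :
    (relInterior (unitTrace H) (wignerPositive H)).Nonempty := by
  have hR := hH.trans (fockSpan_le_range N)
  obtain ⟨C, hC, hbound⟩ := exists_norm_wigner_le hH
  set k := C * ‖(1 : H →L[ℂ] H)‖ + 1 with hk
  have hk0 : 0 < k := by positivity
  set η := δ / 2 / k with hη
  have hη0 : 0 < η := by positivity
  have hηk : η * k = δ / 2 := div_mul_cancel₀ _ hk0.ne'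
  set A : H →L[ℂ] H := B + (η : ℂ) • 1 with hA
  have hAsa : IsSelfAdjoint A := hB.isSelfAdjoint.add ((isSelfAdjoint_ofReal η).smul (.one _))
  have hre : ∀ (T : H →L[ℂ] H) (x ξ : ℝ), -(C * ‖T‖ * wignerEnvelope N x ξ) ≤ (wigner T x ξ).re :=
    fun T x ξ => (abs_le.1 ((Complex.abs_re_le_norm _).trans (hbound T x ξ))).1
  have hAW : ∀ x ξ : ℝ, δ / 2 * wignerEnvelope N x ξ ≤ (wigner A x ξ).re := by
    intro x ξ
    rw [hA, wigner_add hR, wigner_smul hR, Complex.add_re, Complex.re_ofReal_mul]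
    have h1 := hre 1 x ξ
    have h2 := hW x ξ
    have h3 := wignerEnvelope_pos N x ξ
    have h4 : η * (C * ‖(1 : H →L[ℂ] H)‖) ≤ δ / 2 := by
      rw [← hηk, hk]; nlinarith
    nlinarith [mul_le_mul_of_nonneg_left h1 hη0.le, mul_le_mul_of_nonneg_right h4 h3.le]
  have hAlow : ∀ v : H, η * ‖v‖ ^ 2 ≤ (inner ℂ (A v) v).re := by
    intro v
    have h1 : 0 ≤ (inner ℂ (B v) v).re := hB.re_inner_nonneg_left v
    have h2 : (inner ℂ v v).re = ‖v‖ ^ 2 := inner_self_eq_norm_sq (𝕜 := ℂ) v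
    have h3 : (inner ℂ (A v) v).re = (inner ℂ (B v) v).re + η * (inner ℂ v v).re := by
      simp [hA]
    rw [h3, h2]
    linarith
  set τ := (trace A).re with hτ
  have hτ0 : 0 < τ := by
    -- the trace vanishes only on the zero space, where all Wigner functions vanish
    have hne : Nonempty (BasisIndex H) := by
      by_contra hemp
      rw [not_nonempty_iff] at hemp
      have h1 := hAW 0 0
      rw [wigner_eq_sum hR, Finset.univ_eq_empty, Finset.sum_empty, Complex.zero_re] at h1
      have := mul_pos (half_pos hδ) (wignerEnvelope_pos N 0 0)
      linarith
    exact (mul_pos (Nat.cast_pos.2 Fintype.card_pos) hη0).trans_le (card_mul_le_re_trace hAlow)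
  have hρ : ((τ⁻¹ : ℝ) : ℂ) • A ∈ unitTrace H := by
    refine ⟨isTraceClass_of_finiteDimensional _, (isSelfAdjoint_ofReal τ⁻¹).smul hAsa, ?_⟩
    rw [trace_smul, trace_eq_ofReal_re_of_isSelfAdjoint hAsa, ← hτ, ← Complex.ofReal_mul,
      inv_mul_cancel₀ hτ0.ne', Complex.ofReal_one]
  refine ⟨((τ⁻¹ : ℝ) : ℂ) • A, hρ, min (τ⁻¹ * η) (τ⁻¹ * (δ / 2) / (C + 1)), by positivity, ?_⟩
  intro σ hσ hdist
  have hd := (norm_le_traceNorm _).trans_lt hdist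
  have hd1 := hd.trans_le (min_le_left _ _)
  have hd2 := hd.trans_le (min_le_right _ _)
  refine ⟨⟨hσ, isPositive_of_norm_sub_le hσ.2.1 (fun v => ?_) hd1.le⟩, fun x ξ => ?_⟩
  · have h1 : (inner ℂ ((((τ⁻¹ : ℝ) : ℂ) • A) v) v).re = τ⁻¹ * (inner ℂ (A v) v).re := by
      simp
      ring
    rw [h1, mul_assoc]
    have := hAlow v
    gcongr
  · have h1 : σ = ((τ⁻¹ : ℝ) : ℂ) • A + (σ - ((τ⁻¹ : ℝ) : ℂ) • A) := by abel
    rw [h1, wigner_add hR, wigner_smul hR, Complex.add_re, Complex.re_ofReal_mul]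
    have h2 := hre (σ - ((τ⁻¹ : ℝ) : ℂ) • A) x ξ
    have h3 := wignerEnvelope_pos N x ξ
    have h4 := mul_le_mul_of_nonneg_left (hAW x ξ) (inv_pos.2 hτ0).le
    rw [lt_div_iff₀ (by positivity)] at hd2
    have h5 : C * ‖σ - ((τ⁻¹ : ℝ) : ℂ) • A‖ ≤ τ⁻¹ * (δ / 2) := by
      nlinarith [norm_nonneg (σ - ((τ⁻¹ : ℝ) : ℂ) • A)]
    nlinarith [mul_le_mul_of_nonneg_right h5 h3.le]

end Operators

/-! ### Spaces that contain the vacuum -/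

theorem exists_le_fockSpan_natDegree {N : ℕ} {H : Submodule ℂ L2} (hH : H ≤ fockSpan N)
    (hne : H ≠ ⊥) : ∃ p : ℂ[X], p ≠ 0 ∧ polyGauss p ∈ H ∧ H ≤ fockSpan p.natDegree := by
  set S : Set ℕ := {d | ∃ p : ℂ[X], p ≠ 0 ∧ polyGauss p ∈ H ∧ p.natDegree = d} with hS
  have hbdd : BddAbove S := by
    refine ⟨N, ?_⟩
    rintro _ ⟨p, -, hp, rfl⟩
    obtain ⟨q, hq, he⟩ := mem_fockSpan_iff.1 (hH hp)
    rwa [← polyGauss_injective he]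
  have hSne : S.Nonempty := by
    obtain ⟨ψ, hψ, h0⟩ := H.ne_bot_iff.1 hne
    obtain ⟨q, -, rfl⟩ := mem_fockSpan_iff.1 (hH hψ)
    exact ⟨_, q, fun h => h0 (by rw [h, map_zero]), hψ, rfl⟩
  obtain ⟨p, hp0, hp, hdeg⟩ := Nat.sSup_mem hSne hbdd
  refine ⟨p, hp0, hp, fun ψ hψ => ?_⟩
  obtain ⟨q, -, rfl⟩ := mem_fockSpan_iff.1 (hH hψ)
  refine mem_fockSpan_iff.2 ⟨q, ?_, rfl⟩
  rcases eq_or_ne q 0 with rfl | hq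
  · simp
  · rw [hdeg]
    exact le_csSup hbdd ⟨q, hq, hψ, rfl⟩

/-- If the vacuum lies in `H`, then a vector of maximal degree controls the Wigner function at
infinity, and a large multiple of the vacuum state controls it on bounded sets. -/
theorem relInterior_nonempty_of_fock_zero_mem {N : ℕ} {H : Submodule ℂ L2} [CompleteSpace H]
    (hH : H ≤ fockSpan N) (h0 : fock 0 ∈ H) :
    (relInterior (unitTrace H) (wignerPositive H)).Nonempty := by
  have : FiniteDimensional ℂ H := Submodule.finiteDimensional_of_le hH
  have hg : polyGauss 1 ∈ H := by
    rw [polyGauss_one_eq]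
    exact H.smul_mem _ h0
  have hne : H ≠ ⊥ := by
    rintro rfl
    rw [Submodule.mem_bot, map_eq_zero_iff _ polyGauss_injective] at hg
    exact one_ne_zero hg
  obtain ⟨p, hp0, hp, hHp⟩ := exists_le_fockSpan_natDegree hH hne
  have hR := hHp.trans (fockSpan_le_range _)
  obtain ⟨δ, M, hδ, hM, hlow⟩ := exists_le_re_wignerPoly_self hp0
  set ψ : H := ⟨polyGauss p, hp⟩
  set g : H := ⟨polyGauss 1, hg⟩
  have hpi := Real.pi_pos
  have hsq : 0 < √Real.pi := Real.sqrt_pos.2 hpi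
  set m : ℝ := M / √Real.pi with hm
  have hm0 : 0 ≤ m := by positivity
  have hmM : m * √Real.pi = M := div_mul_cancel₀ _ hsq.ne'
  have hB : (rankOne ℂ ψ ψ + (m : ℂ) • rankOne ℂ g g).IsPositive :=
    (isPositive_rankOne_self ψ).add
      ((isPositive_rankOne_self g).smul_of_nonneg (by exact_mod_cast hm0))
  refine relInterior_wignerPositive_nonempty hHp hB (δ := 1 / Real.pi * δ) (by positivity)
    fun x ξ => ?_
  rw [wigner_add hR, wigner_smul hR, wigner_rankOne hR, wigner_rankOne hR, crossWigner_polyGauss,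
    crossWigner_polyGauss, wignerPoly_one_one, Complex.add_re, Complex.re_ofReal_mul,
    Complex.re_ofReal_mul, Complex.re_ofReal_mul, Complex.ofReal_re, wignerEnvelope]
  have h1 := hlow (x + ξ * Complex.I)
  rw [norm_add_mul_I_sq, ← add_assoc] at h1
  have h2 : 0 ≤ 1 / Real.pi * Real.exp (-x ^ 2 - ξ ^ 2) := by positivity
  calc 1 / Real.pi * δ * ((1 + x ^ 2 + ξ ^ 2) ^ p.natDegree * Real.exp (-x ^ 2 - ξ ^ 2))
      = 1 / Real.pi * Real.exp (-x ^ 2 - ξ ^ 2) *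
        (δ * (1 + x ^ 2 + ξ ^ 2) ^ p.natDegree - M + m * √Real.pi) := by rw [hmM]; ring
    _ ≤ 1 / Real.pi * Real.exp (-x ^ 2 - ξ ^ 2) *
        ((wignerPoly p p (x + ξ * Complex.I)).re + m * √Real.pi) := by gcongr
    _ = _ := by ring

theorem wignerPositive_subset_unitTrace (H : Submodule ℂ L2) [CompleteSpace H] :
    wignerPositive H ⊆ unitTrace H := fun _ h => h.1.1

theorem affHull_and_intrinsicInt_of_fock_zero_mem {N : ℕ} {H : Submodule ℂ L2} [CompleteSpace H]
    (hH : H ≤ fockSpan N) (h0 : fock 0 ∈ H) :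
    (relInterior (unitTrace H) (wignerPositive H)).Nonempty ∧
      affHull (wignerPositive H) = unitTrace H ∧
      affHull (densityMatrices H) = unitTrace H ∧
      relInterior (unitTrace H) (wignerPositive H) = intrinsicInt (wignerPositive H) := by
  have : FiniteDimensional ℂ H := Submodule.finiteDimensional_of_le hH
  have h1 := relInterior_nonempty_of_fock_zero_mem hH h0
  have h2 := affHull_eq_unitTrace (wignerPositive_subset_unitTrace H) h1
  refine ⟨h1, h2, (affHull_subset_unitTrace fun _ h => h.1).antisymm ?_, by rw [intrinsicInt, h2]⟩
  rw [← h2]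
  exact affineSpan_mono ℝ fun _ h => h.1

/-! ### Spaces in general position with respect to the vacuum -/

theorem inner_polyGauss_eq_integral_eval (p q : ℂ[X]) :
    inner ℂ (polyGauss p) (polyGauss q) =
      ∫ x : ℝ, (q * p.map (starRingEnd ℂ)).eval (x : ℂ) * Complex.exp (-(x : ℂ) ^ 2) := by
  rw [inner_polyGauss]
  simp_rw [conj_gaussFun, gaussFun_mul_gaussFun]

theorem hermiteNorm_zero_ne_zero : (hermiteNorm 0 : ℂ) ≠ 0 := by
  exact_mod_cast (hermiteNorm_pos 0).ne'

theorem fock_zero_notMem_orthogonal {H : Submodule ℂ L2} {p : ℂ[X]} (hp : polyGauss p ∈ H)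
    (h : inner ℂ (polyGauss p) (polyGauss 1) ≠ 0) : fock 0 ∉ Hᗮ := by
  intro h0
  have := (Submodule.mem_orthogonal _ _).1 h0 _ hp
  rw [fock_zero_eq, inner_smul_right] at this
  exact (mul_ne_zero hermiteNorm_zero_ne_zero h) this

theorem inner_one_add_X : inner ℂ (polyGauss (1 + X)) (polyGauss 1) = (√Real.pi : ℝ) := by
  rw [inner_polyGauss_eq_integral_eval]
  have := integral_quartic_mul_cexp 1 1 0 0 0
  simp only [zero_mul, add_zero, one_mul, zero_div, mul_zero, mul_one] at this
  rw [← this]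
  simp

theorem inner_one_add_X_sq : inner ℂ (polyGauss (1 + X ^ 2)) (polyGauss 1)
    = (√Real.pi : ℝ) * (3 / 2) := by
  rw [inner_polyGauss_eq_integral_eval]
  have := integral_quartic_mul_cexp 1 0 1 0 0
  simp only [zero_mul, add_zero, one_mul, mul_zero] at this
  norm_num at this ⊢
  exact this

theorem wignerPoly_one_add_X : wignerPoly (1 + X) (1 + X) (-1) = -((√Real.pi : ℝ) / 2) := by
  have := integral_quartic_mul_cexp 0 0 (-1) 0 0
  simp only [zero_mul, add_zero, mul_zero, zero_add] at this
  rw [wignerPoly]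
  simp only [Polynomial.map_add, Polynomial.map_one, map_X, eval_add, eval_one, eval_X, map_neg,
    map_one]
  convert this using 1
  · congr 1
    ext t
    ring
  · ring

/-- A line spanned by a polynomial `p` times the Gaussian carries only one state, the
normalized projection onto the line. -/
theorem norm_sq_mul_wigner_of_span_singleton (p : ℂ[X]) [CompleteSpace (ℂ ∙ polyGauss p)]
    {ρ : (ℂ ∙ polyGauss p) →L[ℂ] (ℂ ∙ polyGauss p)} (hρ : trace ρ = 1) (x ξ : ℝ) :
    inner ℂ (polyGauss p) (polyGauss p) * wigner ρ x ξ
      = crossWigner (polyGauss p) (polyGauss p) x ξ := by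
  have hR : (ℂ ∙ polyGauss p) ≤ LinearMap.range polyGauss :=
    (Submodule.span_singleton_le_iff_mem _ _).2 ⟨p, rfl⟩
  set ψ : (ℂ ∙ polyGauss p) := ⟨polyGauss p, Submodule.mem_span_singleton_self _⟩ with hψ
  have hspan : ∀ v : (ℂ ∙ polyGauss p), ∃ a : ℂ, a • ψ = v := fun v => by
    obtain ⟨a, ha⟩ := Submodule.mem_span_singleton.1 v.2
    exact ⟨a, Subtype.ext ha⟩
  obtain ⟨l, hl⟩ := hspan (ρ ψ)
  choose a ha using fun i => hspan (basis _ i)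
  have htr : trace ρ = (∑ i, a i * (starRingEnd ℂ) (a i) * l) * inner ℂ ψ ψ := by
    rw [trace_eq_sum, Finset.sum_mul]
    refine Finset.sum_congr rfl fun i _ => ?_
    rw [← ha i, map_smul, ← hl]
    change inner ℂ (a i • polyGauss p) (a i • l • polyGauss p)
      = _ * inner ℂ (polyGauss p) (polyGauss p)
    rw [inner_smul_left, inner_smul_right, inner_smul_right]
    ring
  have hw : wigner ρ x ξ = (∑ i, a i * (starRingEnd ℂ) (a i) * l) * wignerSesq hR x ξ ψ ψ := by
    rw [wigner_eq_sum hR, Finset.sum_mul]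
    refine Finset.sum_congr rfl fun i _ => ?_
    have e : ρ (a i • ψ) = (a i * l) • ψ := by rw [map_smul, ← hl, smul_smul]
    rw [← ha i, e, (wignerSesq hR x ξ).map_smul, LinearMap.smul_apply, LinearMap.map_smulₛₗ,
      smul_eq_mul, smul_eq_mul]
    ring
  have h1 : inner ℂ (polyGauss p) (polyGauss p) = inner ℂ ψ ψ := rfl
  rw [hρ] at htr
  rw [hw, h1, ← mul_assoc, mul_comm (inner ℂ ψ ψ), ← htr, one_mul, wignerSesq_apply]

/-- The line spanned by `(1 + x) exp(-x²/2)` carries no Wigner-positive state, since the Wigner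
function of its only state is negative at `(-1, 0)`. -/
theorem wignerPositive_span_one_add_X [CompleteSpace (ℂ ∙ polyGauss (1 + X))] :
    wignerPositive (ℂ ∙ polyGauss (1 + X)) = ∅ := by
  rw [Set.eq_empty_iff_forall_notMem]
  rintro ρ ⟨⟨hρ, -⟩, hpos⟩
  have h1 := norm_sq_mul_wigner_of_span_singleton (1 + X) hρ.2.2 (-1) 0
  have h2 := hpos (-1) 0
  rw [crossWigner_polyGauss] at h1
  have e : (((-1 : ℝ) : ℂ) + ((0 : ℝ) : ℂ) * Complex.I) = -1 := by simp
  rw [e, wignerPoly_one_add_X, inner_self_eq_norm_sq_to_K] at h1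
  have h3 := congrArg Complex.re h1
  have hs : 0 < √Real.pi := Real.sqrt_pos.2 Real.pi_pos
  have hpi := Real.pi_pos
  have e2 : -(((√Real.pi : ℝ) : ℂ) / 2) = ((-(√Real.pi / 2) : ℝ) : ℂ) := by push_cast; ring
  have e3 : ((‖polyGauss (1 + X)‖ : ℂ)) ^ 2 = ((‖polyGauss (1 + X)‖ ^ 2 : ℝ) : ℂ) := by
    push_cast; ring
  rw [e2, RCLike.ofReal_eq_complex_ofReal, e3, Complex.re_ofReal_mul, Complex.re_ofReal_mul,
    Complex.ofReal_re] at h3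
  have h4 : 0 ≤ ‖polyGauss (1 + X)‖ ^ 2 * (wigner ρ (-1) 0).re := by positivity
  have h5 : 0 < 1 / Real.pi * Real.exp (-(-1) ^ 2 - 0 ^ 2) * (√Real.pi / 2) := by positivity
  linarith

theorem fock_zero_notMem_span_one_add_X : fock 0 ∉ ℂ ∙ polyGauss (1 + X) := by
  intro h
  obtain ⟨a, ha⟩ := Submodule.mem_span_singleton.1 h
  rw [fock_zero_eq, ← map_smul, ← map_smul] at ha
  have h1 := polyGauss_injective ha
  have h2 := congrArg (fun p : ℂ[X] => p.coeff 1) h1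
  have h3 := congrArg (fun p : ℂ[X] => p.coeff 0) h1
  simp [coeff_one] at h2 h3
  exact hermiteNorm_zero_ne_zero (h3.symm.trans h2)

theorem wignerPoly_one_add_X_sq_add (x ξ : ℝ) :
    wignerPoly (1 + X ^ 2) (1 + X ^ 2) (x + ξ * Complex.I) +
        5 * wignerPoly X X (x + ξ * Complex.I)
      = (√Real.pi : ℝ) * (1 / 4 + 6 * x ^ 2 + (x ^ 2 + ξ ^ 2) ^ 2 : ℝ) := by
  set z : ℂ := x + ξ * Complex.I with hz
  set c := (starRingEnd ℂ) z with hc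
  have h1 := integral_quartic_mul_cexp ((1 + c ^ 2) * (1 + z ^ 2))
    (2 * c * (1 + z ^ 2) - 2 * z * (1 + c ^ 2)) (1 + c ^ 2 + (1 + z ^ 2) - 4 * c * z)
    (2 * c - 2 * z) 1
  have h2 := integral_quartic_mul_cexp (c * z) (z - c) (-1) 0 0
  have h3 : wignerPoly (1 + X ^ 2) (1 + X ^ 2) z = (√Real.pi : ℝ) *
      ((1 + c ^ 2) * (1 + z ^ 2) + (1 + c ^ 2 + (1 + z ^ 2) - 4 * c * z) / 2 + 3 / 4 * 1) := by
    rw [← h1, wignerPoly]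
    congr 1
    ext t
    simp [← hc]
    ring
  have h4 : wignerPoly X X z = (√Real.pi : ℝ) * (c * z + -1 / 2 + 3 / 4 * 0) := by
    rw [← h2, wignerPoly]
    congr 1
    ext t
    simp [← hc]
    ring
  have hcz : c = x - ξ * Complex.I := by simp [hc, hz, sub_eq_add_neg]
  have h5 : c * z = (x : ℂ) ^ 2 + (ξ : ℂ) ^ 2 := by
    rw [hcz, hz]
    linear_combination (-(ξ : ℂ) ^ 2) * Complex.I_sq
  have h6 : c ^ 2 + z ^ 2 = 2 * ((x : ℂ) ^ 2 - (ξ : ℂ) ^ 2) := by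
    rw [hcz, hz]
    linear_combination (2 * (ξ : ℂ) ^ 2) * Complex.I_sq
  rw [h3, h4]
  push_cast
  linear_combination ((√Real.pi : ℝ) : ℂ) * ((c * z + (x : ℂ) ^ 2 + (ξ : ℂ) ^ 2 + 3) * h5
    + (3 / 2) * h6)

theorem span_pair_le_fockSpan :
    Submodule.span ℂ {polyGauss (1 + X ^ 2), polyGauss X} ≤ fockSpan 2 := by
  refine Submodule.span_le.2 ?_
  rintro _ (rfl | rfl)
  · exact mem_fockSpan_iff.2 ⟨_, by compute_degree, rfl⟩
  · exact mem_fockSpan_iff.2 ⟨_, by compute_degree!, rfl⟩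

/-- On the plane spanned by `(1 + x²) exp(-x²/2)` and `x exp(-x²/2)` the Wigner function of a
suitable mixture is strictly positive, up to infinity. -/
theorem relInterior_nonempty_span_pair
    [CompleteSpace (Submodule.span ℂ {polyGauss (1 + X ^ 2), polyGauss X})] :
    (relInterior (unitTrace (Submodule.span ℂ {polyGauss (1 + X ^ 2), polyGauss X}))
      (wignerPositive (Submodule.span ℂ {polyGauss (1 + X ^ 2), polyGauss X}))).Nonempty := by
  set H := Submodule.span ℂ {polyGauss (1 + X ^ 2), polyGauss X} with hHdef
  have hH : H ≤ fockSpan 2 := span_pair_le_fockSpan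
  have hR := hH.trans (fockSpan_le_range _)
  have : FiniteDimensional ℂ H := Submodule.finiteDimensional_of_le hH
  set ψ : H := ⟨polyGauss (1 + X ^ 2), Submodule.subset_span (by simp)⟩
  set φ : H := ⟨polyGauss X, Submodule.subset_span (by simp)⟩
  -- with weight 5 the Wigner function is proportional to `(1/4 + 6x² + |z|⁴) exp(-|z|²)`
  have hB : (rankOne ℂ ψ ψ + ((5 : ℝ) : ℂ) • rankOne ℂ φ φ).IsPositive :=
    (isPositive_rankOne_self ψ).add
      ((isPositive_rankOne_self φ).smul_of_nonneg (Complex.zero_le_real.2 (by norm_num)))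
  have hs : 0 < √Real.pi := Real.sqrt_pos.2 Real.pi_pos
  have hpi := Real.pi_pos
  refine relInterior_wignerPositive_nonempty hH hB (δ := 1 / Real.pi * (√Real.pi / 8))
    (by positivity) fun x ξ => ?_
  have h1 := wignerPoly_one_add_X_sq_add x ξ
  rw [wigner_add hR, wigner_smul hR, wigner_rankOne hR, wigner_rankOne hR, crossWigner_polyGauss,
    crossWigner_polyGauss, wignerEnvelope, Complex.ofReal_ofNat, mul_left_comm (5 : ℂ),
    ← mul_add, h1, Complex.re_ofReal_mul, Complex.re_ofReal_mul, Complex.ofReal_re]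
  calc 1 / Real.pi * (√Real.pi / 8) * ((1 + x ^ 2 + ξ ^ 2) ^ 2 * Real.exp (-x ^ 2 - ξ ^ 2))
      = 1 / Real.pi * Real.exp (-x ^ 2 - ξ ^ 2) * (√Real.pi * ((1 + x ^ 2 + ξ ^ 2) ^ 2 / 8)) := by
        ring
    _ ≤ _ := by
      gcongr
      nlinarith [sq_nonneg (1 - x ^ 2 - ξ ^ 2), sq_nonneg x, sq_nonneg (x ^ 2 + ξ ^ 2)]

theorem fock_zero_notMem_span_pair :
    fock 0 ∉ Submodule.span ℂ {polyGauss (1 + X ^ 2), polyGauss X} := by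
  intro h
  obtain ⟨a, b, ha⟩ := Submodule.mem_span_pair.1 h
  rw [fock_zero_eq, ← map_smul, ← map_smul, ← map_smul, ← map_add] at ha
  have h1 := polyGauss_injective ha
  have h2 := congrArg (fun p : ℂ[X] => p.coeff 2) h1
  have h3 := congrArg (fun p : ℂ[X] => p.coeff 0) h1
  simp [coeff_one, coeff_X] at h2 h3
  exact hermiteNorm_zero_ne_zero (h3.symm.trans h2)

theorem fockSpan_mono {M N : ℕ} (h : M ≤ N) : fockSpan M ≤ fockSpan N :=
  Submodule.span_mono fun _ ⟨n, hn, e⟩ => ⟨n, hn.trans h, e⟩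

theorem span_one_add_X_le_fockSpan : (ℂ ∙ polyGauss (1 + X)) ≤ fockSpan 1 :=
  (Submodule.span_singleton_le_iff_mem _ _).2 (mem_fockSpan_iff.2 ⟨_, by compute_degree, rfl⟩)

theorem exists_wignerPositive_eq_empty {N : ℕ} (hN : 1 ≤ N) :
    ∃ (H : Submodule ℂ L2) (_ : CompleteSpace H), H ≤ fockSpan N ∧
      fock 0 ∉ H ∧ fock 0 ∉ Hᗮ ∧ wignerPositive H = ∅ := by
  have : FiniteDimensional ℂ (ℂ ∙ polyGauss (1 + X)) :=
    Submodule.finiteDimensional_of_le span_one_add_X_le_fockSpan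
  have hc : CompleteSpace (ℂ ∙ polyGauss (1 + X)) := FiniteDimensional.complete ℂ _
  refine ⟨ℂ ∙ polyGauss (1 + X), hc,
    span_one_add_X_le_fockSpan.trans (fockSpan_mono hN),
    fock_zero_notMem_span_one_add_X,
    fock_zero_notMem_orthogonal (Submodule.mem_span_singleton_self _) ?_,
    wignerPositive_span_one_add_X⟩
  rw [inner_one_add_X]
  exact_mod_cast (Real.sqrt_pos.2 Real.pi_pos).ne'

theorem exists_relInterior_wignerPositive_nonempty {N : ℕ} (hN : 2 ≤ N) :
    ∃ (H : Submodule ℂ L2) (_ : CompleteSpace H), H ≤ fockSpan N ∧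
      fock 0 ∉ H ∧ fock 0 ∉ Hᗮ ∧ (relInterior (unitTrace H) (wignerPositive H)).Nonempty := by
  have : FiniteDimensional ℂ (Submodule.span ℂ {polyGauss (1 + X ^ 2), polyGauss X}) :=
    Submodule.finiteDimensional_of_le span_pair_le_fockSpan
  have hc : CompleteSpace (Submodule.span ℂ {polyGauss (1 + X ^ 2), polyGauss X}) :=
    FiniteDimensional.complete ℂ _
  refine ⟨Submodule.span ℂ {polyGauss (1 + X ^ 2), polyGauss X}, hc,
    span_pair_le_fockSpan.trans (fockSpan_mono hN), fock_zero_notMem_span_pair,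
    fock_zero_notMem_orthogonal (p := 1 + X ^ 2) (Submodule.subset_span (by simp)) ?_,
    relInterior_nonempty_span_pair⟩
  rw [inner_one_add_X_sq]
  exact mul_ne_zero (by exact_mod_cast (Real.sqrt_pos.2 Real.pi_pos).ne') (by norm_num)

/-! ### Spaces orthogonal to the vacuum -/

/-- Fourier inversion at the origin, for the Hermitian part of `K`: its Fourier transform is the
real part of the Fourier transform of `K`. -/
theorem re_apply_zero_of_re_fourier_ae_eq_zero {K : ℝ → ℂ} (hc : Continuous K)
    (hi : Integrable K)
    (h : ∀ᵐ ξ : ℝ, (∫ y : ℝ, Complex.exp (-(Complex.I * ξ * y)) * K y).re = 0) :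
    (K 0).re = 0 := by
  set L : ℝ → ℂ := fun y => K y + conj (K (-y)) with hL
  have hi2 : Integrable fun y : ℝ => conj (K (-y)) := by
    have := hi.comp_neg
    exact (Complex.conjLIE.toContinuousLinearEquiv.toContinuousLinearMap.integrable_comp this)
  have hLc : Continuous L := hc.add (Complex.continuous_conj.comp (hc.comp continuous_neg))
  have hLi : Integrable L := hi.add hi2
  have hphase : ∀ (ξ : ℝ) {f : ℝ → ℂ}, Integrable f →
      Integrable fun y : ℝ => Complex.exp (-(Complex.I * ξ * y)) * f y := by
    intro ξ f hf
    refine hf.bdd_mul (c := 1) (by fun_prop : Continuous _).aestronglyMeasurable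
      (Eventually.of_forall fun y => ?_)
    rw [Complex.norm_exp]
    simp
  have hF : ∀ ξ : ℝ, ∫ y : ℝ, Complex.exp (-(Complex.I * ξ * y)) * L y
      = ((2 * (∫ y : ℝ, Complex.exp (-(Complex.I * ξ * y)) * K y).re : ℝ) : ℂ) := by
    intro ξ
    have h1 : ∫ y : ℝ, Complex.exp (-(Complex.I * ξ * y)) * conj (K (-y))
        = conj (∫ y : ℝ, Complex.exp (-(Complex.I * ξ * y)) * K y) := by
      rw [← integral_conj, ← integral_neg_eq_self]
      refine integral_congr_ae (Eventually.of_forall fun y => ?_)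
      simp only [neg_neg, map_mul, ← Complex.exp_conj, map_neg, Complex.conj_I,
        Complex.conj_ofReal]
      congr 2
      push_cast
      ring
    simp only [hL, mul_add]
    rw [integral_add (hphase ξ hi) (hphase ξ hi2), h1, Complex.add_conj]
  have hzero : FourierTransform.fourier L =ᵐ[volume] 0 := by
    have hq := (Measure.quasiMeasurePreserving_smul (volume : Measure ℝ)
      (mul_ne_zero two_ne_zero Real.pi_ne_zero)).ae h
    filter_upwards [hq] with w hw
    have h2 := hF ((2 * Real.pi) • w)
    rw [hw] at h2
    rw [Real.fourier_eq', Pi.zero_apply]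
    rw [mul_zero, Complex.ofReal_zero] at h2
    rw [← h2]
    refine integral_congr_ae (Eventually.of_forall fun y => ?_)
    simp only [smul_eq_mul]
    congr 2
    simp
    ring
  have hinv := hLc.fourierInv_fourier_eq hLi ((integrable_zero _ _ _).congr hzero.symm)
  have h0 : L 0 = 0 := by
    rw [← hinv, Real.fourierInv_eq']
    refine integral_eq_zero_of_ae ?_
    filter_upwards [hzero] with w hw
    simp [hw]
  have h1 := congrArg Complex.re h0
  simp [hL] at h1
  linarith

theorem integrable_wigner_kernel (p q : ℂ[X]) (x : ℝ) :
    Integrable fun y : ℝ => gaussFun p (x + y / 2) * conj (gaussFun q (x - y / 2)) := by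
  have h1 := (integrable_eval_mul_cexp
    (p.comp (C (x : ℂ) + X) * (q.map (starRingEnd ℂ)).comp (C (x : ℂ) - X))).const_mul
      (Complex.exp (-(x : ℂ) ^ 2))
  refine (h1.comp_div two_ne_zero).congr (Eventually.of_forall fun y => ?_)
  have e : Complex.exp (-(x : ℂ) ^ 2) * Complex.exp (-((y / 2 : ℝ) : ℂ) ^ 2)
      = Complex.exp (-((x + y / 2 : ℝ) : ℂ) ^ 2 / 2) *
        Complex.exp (-((x - y / 2 : ℝ) : ℂ) ^ 2 / 2) := by
    rw [← Complex.exp_add, ← Complex.exp_add]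
    congr 1
    push_cast
    ring
  simp only [conj_gaussFun]
  simp only [gaussFun, eval_mul, eval_comp, eval_add, eval_sub, eval_X, eval_C]
  push_cast at e ⊢
  linear_combination (eval ((x : ℂ) + y / 2) p *
    eval ((x : ℂ) - y / 2) (Polynomial.map (starRingEnd ℂ) q)) * e

theorem integrable_cexp_neg_sq : Integrable fun t : ℝ => Complex.exp (-(t : ℂ) ^ 2) := by
  simpa using integrable_eval_mul_cexp 1

theorem integral_cexp_neg_sq_mul_phase (y : ℝ) :
    ∫ ξ : ℝ, Complex.exp (-(ξ : ℂ) ^ 2) * Complex.exp (-(Complex.I * ξ * y))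
      = (√Real.pi : ℝ) * Complex.exp (-(y : ℂ) ^ 2 / 4) := by
  have h := integral_shift_pow_zero (y / 2)
  rw [← h, ← integral_mul_const]
  refine integral_congr_ae (Eventually.of_forall fun ξ => ?_)
  simp only [pow_zero, one_mul]
  rw [← Complex.exp_add, ← Complex.exp_add]
  congr 1
  push_cast
  linear_combination ((y : ℂ) ^ 2 / 4) * Complex.I_sq

theorem integrable_crossWigner_kernel_prod (p q : ℂ[X]) (x : ℝ) :
    Integrable (fun z : ℝ × ℝ => Complex.exp (-(z.1 : ℂ) ^ 2) *
      (Complex.exp (-(Complex.I * z.1 * z.2)) *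
        (gaussFun p (x + z.2 / 2) * conj (gaussFun q (x - z.2 / 2)))))
      (volume.prod volume) := by
  have h1 := integrable_cexp_neg_sq.mul_prod (integrable_wigner_kernel p q x)
  have h2 := h1.bdd_mul (c := 1) (f := fun z : ℝ × ℝ => Complex.exp (-(Complex.I * z.1 * z.2)))
    (by fun_prop : Continuous _).aestronglyMeasurable
    (Eventually.of_forall fun z => by rw [Complex.norm_exp]; simp)
  refine h2.congr (Eventually.of_forall fun z => ?_)
  ring

theorem integrable_crossWigner_mul_gaussian (p q : ℂ[X]) (x : ℝ) :
    Integrable fun ξ : ℝ =>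
      Complex.exp (-(ξ : ℂ) ^ 2) * crossWigner (polyGauss p) (polyGauss q) x ξ := by
  refine ((integrable_crossWigner_kernel_prod p q x).integral_prod_left.const_mul
    (1 / (2 * Real.pi : ℝ) : ℂ)).congr (Eventually.of_forall fun ξ => ?_)
  simp only
  rw [crossWigner_polyGauss_eq_integral, integral_const_mul]
  ring

theorem integral_crossWigner_mul_gaussian (p q : ℂ[X]) (x : ℝ) :
    ∫ ξ : ℝ, Complex.exp (-(ξ : ℂ) ^ 2) * crossWigner (polyGauss p) (polyGauss q) x ξ
      = (1 / (2 * Real.pi : ℝ) : ℂ) * (√Real.pi : ℝ) * ∫ y : ℝ, Complex.exp (-(y : ℂ) ^ 2 / 4) *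
        (gaussFun p (x + y / 2) * conj (gaussFun q (x - y / 2))) := by
  have h1 := integral_integral_swap (f := fun ξ y : ℝ => Complex.exp (-(ξ : ℂ) ^ 2) *
      (Complex.exp (-(Complex.I * ξ * y)) *
        (gaussFun p (x + y / 2) * conj (gaussFun q (x - y / 2)))))
    (integrable_crossWigner_kernel_prod p q x)
  have h2 : ∀ y : ℝ, ∫ ξ : ℝ, Complex.exp (-(ξ : ℂ) ^ 2) *
      (Complex.exp (-(Complex.I * ξ * y)) *
        (gaussFun p (x + y / 2) * conj (gaussFun q (x - y / 2))))
      = (√Real.pi : ℝ) * (Complex.exp (-(y : ℂ) ^ 2 / 4) *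
        (gaussFun p (x + y / 2) * conj (gaussFun q (x - y / 2)))) := by
    intro y
    simp_rw [← mul_assoc]
    rw [← integral_cexp_neg_sq_mul_phase, integral_mul_const, integral_mul_const]
  simp only [h2] at h1
  rw [integral_const_mul] at h1
  rw [mul_assoc, ← h1, ← integral_const_mul]
  refine integral_congr_ae (Eventually.of_forall fun ξ => ?_)
  simp only
  rw [crossWigner_polyGauss_eq_integral, integral_const_mul]
  ring

/-- Integrating a Wigner function against the Gaussian in `ξ` gives a convolution in `x`. -/
theorem gaussian_mul_integral_crossWigner_eq_convolution (p q : ℂ[X]) (x : ℝ) :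
    Complex.exp (-(x : ℂ) ^ 2) *
        ∫ ξ : ℝ, Complex.exp (-(ξ : ℂ) ^ 2) * crossWigner (polyGauss p) (polyGauss q) x ξ
      = (1 / Real.pi : ℝ) * (√Real.pi : ℝ) *
        convolution (fun t : ℝ => p.eval (t : ℂ) * Complex.exp (-(t : ℂ) ^ 2))
          (fun t : ℝ => (q.map (starRingEnd ℂ)).eval (t : ℂ) * Complex.exp (-(t : ℂ) ^ 2))
          (ContinuousLinearMap.mul ℂ ℂ) volume (x * 2) := by
  set g₁ : ℝ → ℂ := fun t => p.eval (t : ℂ) * Complex.exp (-(t : ℂ) ^ 2) with hg₁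
  set g₂ : ℝ → ℂ := fun t => (q.map (starRingEnd ℂ)).eval (t : ℂ) * Complex.exp (-(t : ℂ) ^ 2)
    with hg₂
  have h1 : ∀ y : ℝ, Complex.exp (-(x : ℂ) ^ 2) * (Complex.exp (-(y : ℂ) ^ 2 / 4) *
      (gaussFun p (x + y / 2) * conj (gaussFun q (x - y / 2))))
      = g₁ (x + y / 2) * g₂ (x - y / 2) := by
    intro y
    have e : Complex.exp (-(x : ℂ) ^ 2) * Complex.exp (-(y : ℂ) ^ 2 / 4) *
        (Complex.exp (-((x + y / 2 : ℝ) : ℂ) ^ 2 / 2) *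
          Complex.exp (-((x - y / 2 : ℝ) : ℂ) ^ 2 / 2))
        = Complex.exp (-((x + y / 2 : ℝ) : ℂ) ^ 2) *
          Complex.exp (-((x - y / 2 : ℝ) : ℂ) ^ 2) := by
      rw [← Complex.exp_add, ← Complex.exp_add, ← Complex.exp_add, ← Complex.exp_add]
      congr 1
      push_cast
      ring
    simp only [conj_gaussFun]
    simp only [gaussFun, hg₁, hg₂]
    linear_combination (eval ((x + y / 2 : ℝ) : ℂ) p *
      eval ((x - y / 2 : ℝ) : ℂ) (Polynomial.map (starRingEnd ℂ) q)) * e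
  have h2 : ∫ y : ℝ, g₁ (x + y / 2) * g₂ (x - y / 2) = 2 * ∫ s : ℝ, g₁ s * g₂ (x * 2 - s) := by
    have h3 := Measure.integral_comp_div (fun s : ℝ => g₁ (x + s) * g₂ (x - s)) 2
    rw [h3, abs_of_pos (by norm_num), Complex.real_smul, Complex.ofReal_ofNat,
      ← integral_add_left_eq_self (fun s : ℝ => g₁ s * g₂ (x * 2 - s)) x]
    congr 2
    ext s
    congr 2
    ring
  rw [integral_crossWigner_mul_gaussian, mul_left_comm, ← integral_const_mul]
  simp only [h1]
  rw [h2, convolution_def]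
  simp only [ContinuousLinearMap.mul_apply']
  push_cast
  ring

theorem integrable_gaussian_mul_integral_crossWigner (p q : ℂ[X]) :
    Integrable fun x : ℝ => Complex.exp (-(x : ℂ) ^ 2) *
      ∫ ξ : ℝ, Complex.exp (-(ξ : ℂ) ^ 2) * crossWigner (polyGauss p) (polyGauss q) x ξ := by
  simp only [gaussian_mul_integral_crossWigner_eq_convolution]
  exact (((integrable_eval_mul_cexp p).integrable_convolution (ContinuousLinearMap.mul ℂ ℂ)
    (integrable_eval_mul_cexp _)).comp_mul_right' two_ne_zero).const_mul _

/-- A case of Moyal's identity: the overlap of a Wigner function with that of the vacuum, which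
is a multiple of `exp(-x² - ξ²)`, vanishes if the vacuum is orthogonal to the second argument. -/
theorem integral_gaussian_mul_integral_crossWigner_eq_zero (p : ℂ[X]) {q : ℂ[X]}
    (hq : inner ℂ (polyGauss q) (polyGauss 1) = 0) :
    ∫ x : ℝ, Complex.exp (-(x : ℂ) ^ 2) *
      ∫ ξ : ℝ, Complex.exp (-(ξ : ℂ) ^ 2) * crossWigner (polyGauss p) (polyGauss q) x ξ = 0 := by
  simp only [gaussian_mul_integral_crossWigner_eq_convolution]
  rw [inner_polyGauss_eq_integral_eval, one_mul] at hq
  rw [integral_const_mul, Measure.integral_comp_mul_right (fun x => convolution _ _ _ _ x),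
    integral_convolution _ (integrable_eval_mul_cexp p) (integrable_eval_mul_cexp _), hq]
  simp

/-- A Wigner-positive state on a space orthogonal to the vacuum would have zero overlap with the
positive Wigner function of the vacuum, hence vanishing Wigner function, kernel and trace. -/
theorem wignerPositive_eq_empty_of_fock_zero_mem_orthogonal {N : ℕ}
    {H : Submodule ℂ L2} [CompleteSpace H] (hH : H ≤ fockSpan N)
    (h0 : fock 0 ∈ Hᗮ) : wignerPositive H = ∅ := by
  have : FiniteDimensional ℂ H := Submodule.finiteDimensional_of_le hH
  have hR := hH.trans (fockSpan_le_range N)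
  rw [Set.eq_empty_iff_forall_notMem]
  rintro ρ ⟨⟨⟨-, -, htr⟩, -⟩, hpos⟩
  choose p hp using fun i => hR (ρ (basis H i)).2
  choose q hq using fun i => hR (basis H i).2
  have horth : ∀ i, inner ℂ (polyGauss (q i)) (polyGauss 1) = 0 := by
    intro i
    rw [polyGauss_one_eq, inner_smul_right, hq,
      (Submodule.mem_orthogonal _ _).1 h0 _ (basis H i).2, mul_zero]
  have hw : ∀ x ξ, wigner ρ x ξ = ∑ i, crossWigner (polyGauss (p i)) (polyGauss (q i)) x ξ := by
    intro x ξ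
    simp only [wigner_eq_sum hR, wignerSesq_apply, hp, hq]
  -- the overlap of the Wigner function with the Gaussian
  have hwi : ∀ x, Integrable fun ξ : ℝ => Complex.exp (-(ξ : ℂ) ^ 2) * wigner ρ x ξ := by
    intro x
    simp only [hw, Finset.mul_sum]
    exact integrable_finsetSum _ fun i _ => integrable_crossWigner_mul_gaussian _ _ x
  set G : ℝ → ℂ := fun x => Complex.exp (-(x : ℂ) ^ 2) *
    ∫ ξ : ℝ, Complex.exp (-(ξ : ℂ) ^ 2) * wigner ρ x ξ with hG
  have hGsum : G = fun x : ℝ => ∑ i, Complex.exp (-(x : ℂ) ^ 2) * ∫ ξ : ℝ,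
      Complex.exp (-(ξ : ℂ) ^ 2) * crossWigner (polyGauss (p i)) (polyGauss (q i)) x ξ := by
    ext x
    simp only [hG, hw, Finset.mul_sum]
    rw [integral_finsetSum _ fun i _ => integrable_crossWigner_mul_gaussian _ _ x, Finset.mul_sum]
  have hGi : Integrable G := by
    rw [hGsum]
    exact integrable_finsetSum _ fun i _ => integrable_gaussian_mul_integral_crossWigner _ _
  have hG0 : ∫ x, G x = 0 := by
    rw [hGsum, integral_finsetSum _ fun i _ => integrable_gaussian_mul_integral_crossWigner _ _]
    exact Finset.sum_eq_zero fun i _ =>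
      integral_gaussian_mul_integral_crossWigner_eq_zero _ (horth i)
  have hexp : ∀ t : ℝ, Complex.exp (-(t : ℂ) ^ 2) = (Real.exp (-t ^ 2) : ℝ) := by
    intro t
    push_cast
    rfl
  have hwre : ∀ x ξ : ℝ, (Complex.exp (-(ξ : ℂ) ^ 2) * wigner ρ x ξ).re
      = Real.exp (-ξ ^ 2) * (wigner ρ x ξ).re := by
    intro x ξ
    rw [hexp, Complex.re_ofReal_mul]
  have hGre : ∀ x, (G x).re
      = Real.exp (-x ^ 2) * ∫ ξ : ℝ, Real.exp (-ξ ^ 2) * (wigner ρ x ξ).re := by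
    intro x
    simp only [hG]
    rw [hexp, Complex.re_ofReal_mul]
    congr 1
    have := integral_re (hwi x)
    simp only [RCLike.re_to_complex, hwre] at this
    exact this.symm
  have hGnn : ∀ x, 0 ≤ (G x).re := by
    intro x
    rw [hGre]
    exact mul_nonneg (Real.exp_pos _).le
      (integral_nonneg fun ξ => mul_nonneg (Real.exp_pos _).le (hpos x ξ))
  have hGae : ∀ᵐ x : ℝ, (G x).re = 0 := by
    have h1 := integral_re hGi
    rw [hG0] at h1
    exact (integral_eq_zero_iff_of_nonneg hGnn hGi.re).1 (by simpa using h1)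
  -- the kernel vanishes on the diagonal
  have hker : ∀ᵐ x : ℝ, (∑ i, gaussFun (p i) x * conj (gaussFun (q i) x)).re = 0 := by
    filter_upwards [hGae] with x hx
    rw [hGre, mul_eq_zero, or_iff_right (Real.exp_pos _).ne',
      integral_eq_zero_iff_of_nonneg
        (fun ξ => mul_nonneg (Real.exp_pos _).le (hpos x ξ))
        (by simpa only [RCLike.re_to_complex, hwre] using (hwi x).re)] at hx
    have hcont : Continuous fun y : ℝ =>
        ∑ i, gaussFun (p i) (x + y / 2) * conj (gaussFun (q i) (x - y / 2)) := by
      refine continuous_finsetSum _ fun i _ => ?_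
      have h1 := continuous_gaussFun (p i)
      have h2 := continuous_gaussFun (q i)
      fun_prop
    have hfin := re_apply_zero_of_re_fourier_ae_eq_zero hcont
      (integrable_finsetSum _ fun i _ => integrable_wigner_kernel (p i) (q i) x) ?_
    · simpa using hfin
    · filter_upwards [hx] with ξ hξ
      have h1 : (wigner ρ x ξ).re = 0 := by
        have := hξ
        simpa [(Real.exp_pos _).ne'] using this
      have hint : ∀ i, Integrable fun y : ℝ => Complex.exp (-(Complex.I * ξ * y)) *
          (gaussFun (p i) (x + y / 2) * conj (gaussFun (q i) (x - y / 2))) := fun i =>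
        (integrable_wigner_kernel (p i) (q i) x).bdd_mul (c := 1)
          (by fun_prop : Continuous _).aestronglyMeasurable
          (Eventually.of_forall fun y => by rw [Complex.norm_exp]; simp)
      have h2 : wigner ρ x ξ = ((1 / (2 * Real.pi) : ℝ) : ℂ) *
          ∫ y : ℝ, Complex.exp (-(Complex.I * ξ * y)) *
            ∑ i, gaussFun (p i) (x + y / 2) * conj (gaussFun (q i) (x - y / 2)) := by
        simp only [hw, crossWigner_polyGauss_eq_integral, Finset.mul_sum]
        rw [integral_finsetSum _ fun i _ => hint i, Finset.mul_sum]
        push_cast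
        rfl
      rw [h2, Complex.re_ofReal_mul, mul_eq_zero] at h1
      exact h1.resolve_left (by positivity)
  -- so the trace vanishes
  have hint : ∀ i, Integrable fun x : ℝ => gaussFun (p i) x * conj (gaussFun (q i) x) := by
    intro i
    simp only [conj_gaussFun, gaussFun_mul_gaussFun]
    exact integrable_eval_mul_cexp _
  have htr2 : trace ρ = ∫ x : ℝ, ∑ i, gaussFun (p i) x * conj (gaussFun (q i) x) := by
    rw [trace_eq_sum, integral_finsetSum _ fun i _ => hint i]
    refine Finset.sum_congr rfl fun i _ => ?_
    rw [← inner_polyGauss, hp, hq]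
    rfl
  have hre := integral_re (integrable_finsetSum Finset.univ fun i _ => hint i)
  rw [← htr2, htr] at hre
  simp only [RCLike.re_to_complex] at hre
  rw [integral_eq_zero_of_ae hker] at hre
  simp at hre

end

end WignerPositive

theorem mainTheorem8 (N : ℕ) :
    (∀ (H : Submodule ℂ L2) [CompleteSpace H], H ≤ fockSpan N →
      (fock 0 ∈ Hᗮ → wignerPositive H = ∅) ∧
      (fock 0 ∈ H →
        (relInterior (unitTrace H) (wignerPositive H)).Nonempty ∧
        affHull (wignerPositive H) = unitTrace H ∧
        affHull (densityMatrices H) = unitTrace H ∧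
        relInterior (unitTrace H) (wignerPositive H) = intrinsicInt (wignerPositive H))) ∧
    (2 ≤ N →
      (∃ (H : Submodule ℂ L2) (_ : CompleteSpace H), H ≤ fockSpan N ∧
        fock 0 ∉ H ∧ fock 0 ∉ Hᗮ ∧ wignerPositive H = ∅) ∧
      (∃ (H : Submodule ℂ L2) (_ : CompleteSpace H), H ≤ fockSpan N ∧
        fock 0 ∉ H ∧ fock 0 ∉ Hᗮ ∧
        (relInterior (unitTrace H) (wignerPositive H)).Nonempty)) := by
  refine ⟨fun H _ hH => ⟨wignerPositive_eq_empty_of_fock_zero_mem_orthogonal hH,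
    affHull_and_intrinsicInt_of_fock_zero_mem hH⟩, fun hN =>
    ⟨exists_wignerPositive_eq_empty (by omega), exists_relInterior_wignerPositive_nonempty hN⟩⟩
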